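/- Let $k$ be a field and let $H=(H,\Delta,\varepsilon,\Phi,S,\alpha,\beta)$ be a quasi-Hopf algebra over $k$: $H$ is an associative unital $k$-algebra, $\Delta:H\to H\otimes H$ and $\varepsilon:H\to k$ are algebra maps and $\Phi\in H\otimes H\otimes H$ is invertible, such that $(\mathrm{id}\otimes\Delta)(\Delta(h))=\Phi\,(\Delta\otimes\mathrm{id})(\Delta(h))\,\Phi^{-1}$, $(\mathrm{id}\otimes\varepsilon)(\Delta(h))=h\otimes 1$, $(\varepsilon\otimes\mathrm{id})(\Delta(h))=1\otimes h$, $(1\otimes\Phi)(\mathrm{id}\otimes\Delta\otimes\mathrm{id})(\Phi)(\Phi\otimes 1)=(\mathrm{id}\otimes\mathrm{id}\otimes\Delta)(\Phi)(\Delta\otimes\mathrm{id}\otimes\mathrm{id})(\Phi)$ and $(\mathrm{id}\otimes\varepsilon\otimes\mathrm{id})(\Phi)=1$; $S$ is an anti-automorphism of the algebra $H$ and $\alpha,\beta\in H$ satisfy, for all $h\in H$, $S(h_1)\alpha h_2=\varepsilon(h)\alpha$, $h_1\beta S(h_2)=\varepsilon(h)\beta$, $X^1\beta S(X^2)\alpha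 X^3=1$ and $S(x^1)\alpha x^2\beta S(x^3)=1$. Here $\Delta(h)=h_1\otimes h_2$, $\Phi=X^1\otimes X^2\otimes X^3$ and $\Phi^{-1}=x^1\otimes x^2\otimes x^3$ (sums understood). Put $$p_R=p^1\otimes p^2=x^1\otimes x^2\beta S(x^3),\qquad q_R=q^1\otimes q^2=X^1\otimes S^{-1}(\alpha X^3)X^2 .$$ A right $H$-comodule algebra is an associative unital $k$-algebra $B$ with an algebra map $\rho:B\to B\otimes H$, $\rho(b)=b_{(0)}\otimes b_{(1)}$, and an invertible $\Phi_\rho\in B\otimes H\otimes H$ such that $\Phi_\rho(\rho\otimes\mathrm{id})(\rho(b))=(\mathrm{id}\otimes\Delta)(\rho(b))\Phi_\rho$, $(1_B\otimes\Phi)(\mathrm{id}\otimes\Delta\otimes\mathrm{id})(\Phi_\rho)(\Phi_\rho\otimes 1_H)=(\mathrm{id}\otimes\mathrm{id}\otimes\Delta)(\Phi_\rho)(\rho\otimes\mathrm{id}\otimes\mathrm{id})(\Phi_\rho)$, $(\mathrm{id}\otimes\varepsilon)\circ\rho=\mathrm{id}$ and $(\mathrm{id}\otimes\varepsilon\otimes\mathrm{id})(\Phi_\rho)=(\mathrm{id}\otimes\mathrm{id}\otimes\varepsilon)(\Phi_\rho)=1_B\otimes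 1_H$. For example, $H$ is one with $\rho=\Delta$, $\Phi_\rho=\Phi$. A morphism of right $H$-comodule algebras $f:B\to B'$ is an algebra map with $\rho'\circ f=(f\otimes\mathrm{id})\circ\rho$ and $\Phi_{\rho'}=(f\otimes\mathrm{id}\otimes\mathrm{id})(\Phi_\rho)$. A left $H$-module algebra is a left $H$-module $A$ with a bilinear multiplication and a two-sided unit $1_A$ such that $(aa')a''=(X^1\cdot a)[(X^2\cdot a')(X^3\cdot a'')]$, $h\cdot(aa')=(h_1\cdot a)(h_2\cdot a')$ and $h\cdot 1_A=\varepsilon(h)1_A$. A morphism of left $H$-module algebras is an $H$-linear map that is multiplicative and unital. Let $B$ be a right $H$-comodule algebra and let $v:H\to B$ be a morphism of right $H$-comodule algebras. Define $E:B\to B$ by $E(b)=v(q^1)\,b_{(0)}\,v(\beta S(q^2b_{(1)}))$, and let $A=E(B)$, with multiplication $a*a'=E(aa')$, unit $1$ and $H$-action $h\triangleright a=E(v(h)a)$. Let $B^v$ be the vector space $B$ with multiplication, unit and $H$-action $$b\circ b'=v(X^1)\,b\,v(S(x^1X^2)\alpha x^2X^3_1)\,b'\,v(S(x^3X^3_2)),\qquad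 1_{B^v}=v(\beta),\qquad h\triangleright_v b=v(h_1)\,b\,v(S(h_2)).$$ Then $A$ and $B^v$ are left $H$-module algebras, and the map $$\theta:A\to B^v,\qquad \theta(a)=(p^1\triangleright a)\,v(p^2),$$ is an injective morphism of left $H$-module algebras. -/

import Mathlib

open scoped TensorProduct

namespace QuasiHopf

noncomputable section

-- `*` and `1` on nested tensor products are found through the (semi)ring instances; these are
-- definitionally the same operations.
attribute [-instance] Algebra.TensorProduct.instMul Algebra.TensorProduct.instOneTensorProduct

/-! Iterated tensor products are nested to the right: `H ⊗ (H ⊗ H)`, `H ⊗ (H ⊗ (H ⊗ H))`. -/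

/-- `f ⊗ id : M ⊗ N → P ⊗ H ⊗ N` for an algebra map `f : M → P ⊗ H`, with the target nested to
the right. -/
def mapLeft {k M P H N : Type*} [Field k] [Semiring M] [Algebra k M] [Semiring P] [Algebra k P]
    [Semiring H] [Algebra k H] [Semiring N] [Algebra k N] (f : M →ₐ[k] P ⊗[k] H) :
    M ⊗[k] N →ₐ[k] P ⊗[k] (H ⊗[k] N) :=
  (Algebra.TensorProduct.assoc k k k P H N).toAlgHom.comp
    (Algebra.TensorProduct.map f (AlgHom.id k N))

/-- `id ⊗ g : M ⊗ N → M ⊗ P` for an algebra map `g : N → P`. -/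
def mapRight {k M N P : Type*} [Field k] [Semiring M] [Algebra k M] [Semiring N] [Algebra k N]
    [Semiring P] [Algebra k P] (g : N →ₐ[k] P) : M ⊗[k] N →ₐ[k] M ⊗[k] P :=
  Algebra.TensorProduct.map (AlgHom.id k M) g

/-- The linear map `m ⊗ n ↦ f(m) b g(n)`. -/
def sandwich {k M N B : Type*} [Field k] [AddCommGroup M] [Module k M] [AddCommGroup N]
    [Module k N] [Ring B] [Algebra k B] (f : M →ₗ[k] B) (b : B) (g : N →ₗ[k] B) :
    M ⊗[k] N →ₗ[k] B :=
  LinearMap.mul' k B ∘ₗ TensorProduct.map (LinearMap.mulRight k b ∘ₗ f) g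

@[simp] theorem sandwich_tmul {k M N B : Type*} [Field k] [AddCommGroup M] [Module k M]
    [AddCommGroup N] [Module k N] [Ring B] [Algebra k B] (f : M →ₗ[k] B) (b : B)
    (g : N →ₗ[k] B) (m : M) (n : N) : sandwich f b g (m ⊗ₜ n) = f m * b * g n := by
  simp [sandwich]

theorem sandwich_add {k M N B : Type*} [Field k] [AddCommGroup M] [Module k M]
    [AddCommGroup N] [Module k N] [Ring B] [Algebra k B] (f : M →ₗ[k] B) (b b' : B)
    (g : N →ₗ[k] B) : sandwich f (b + b') g = sandwich f b g + sandwich f b' g := by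
  ext m n
  simp [mul_add, add_mul]

theorem sandwich_smul {k M N B : Type*} [Field k] [AddCommGroup M] [Module k M]
    [AddCommGroup N] [Module k N] [Ring B] [Algebra k B] (f : M →ₗ[k] B) (c : k) (b : B)
    (g : N →ₗ[k] B) : sandwich f (c • b) g = c • sandwich f b g := by
  ext m n
  simp

theorem sandwich_add_right {k M N B : Type*} [Field k] [AddCommGroup M] [Module k M]
    [AddCommGroup N] [Module k N] [Ring B] [Algebra k B] (f : M →ₗ[k] B) (b : B)
    (g g' : N →ₗ[k] B) : sandwich f b (g + g') = sandwich f b g + sandwich f b g' := by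
  ext m n
  simp [mul_add]

theorem sandwich_smul_right {k M N B : Type*} [Field k] [AddCommGroup M] [Module k M]
    [AddCommGroup N] [Module k N] [Ring B] [Algebra k B] (f : M →ₗ[k] B) (c : k) (b : B)
    (g : N →ₗ[k] B) : sandwich f b (c • g) = c • sandwich f b g := by
  ext m n
  simp

/-- A quasi-bialgebra structure `(Δ, ε, Φ)` on the associative unital `k`-algebra `H`. -/
structure QuasiBialgebra (k H : Type*) [Field k] [Ring H] [Algebra k H] where
  /-- The comultiplication `Δ`. -/
  comul : H →ₐ[k] H ⊗[k] H
  /-- The counit `ε`. -/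
  counit : H →ₐ[k] k
  /-- The reassociator `Φ`. -/
  Phi : (H ⊗[k] (H ⊗[k] H))ˣ
  /-- `(id ⊗ Δ)(Δ(h)) = Φ (Δ ⊗ id)(Δ(h)) Φ⁻¹`. -/
  quasi_coassoc : ∀ h : H,
    mapRight comul (comul h) = (Phi : H ⊗[k] (H ⊗[k] H)) * mapLeft comul (comul h) * (Phi⁻¹).val
  /-- `(id ⊗ ε)(Δ(h)) = h ⊗ 1`. -/
  counit_right : ∀ h : H, mapRight counit (comul h) = h ⊗ₜ[k] (1 : k)
  /-- `(ε ⊗ id)(Δ(h)) = 1 ⊗ h`. -/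
  counit_left : ∀ h : H,
    Algebra.TensorProduct.map counit (AlgHom.id k H) (comul h) = (1 : k) ⊗ₜ[k] h
  /-- `(1 ⊗ Φ)(id ⊗ Δ ⊗ id)(Φ)(Φ ⊗ 1) = (id ⊗ id ⊗ Δ)(Φ)(Δ ⊗ id ⊗ id)(Φ)`. -/
  pentagon :
    ((1 : H) ⊗ₜ[k] (Phi : H ⊗[k] (H ⊗[k] H))) * mapRight (mapLeft comul) Phi.val *
        mapRight (mapRight Algebra.TensorProduct.includeLeft) Phi.val =
      mapRight (mapRight comul) Phi.val * mapLeft comul Phi.val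
  /-- `(id ⊗ ε ⊗ id)(Φ) = 1 ⊗ 1 ⊗ 1`. -/
  counit_Phi :
    mapRight (Algebra.TensorProduct.map counit (AlgHom.id k H)) Phi.val =
      (1 : H ⊗[k] (k ⊗[k] H))

/-- A quasi-Hopf algebra structure on `H`: a quasi-bialgebra structure together with an
anti-automorphism `S` of the algebra `H` and elements `α`, `β`. -/
structure QuasiHopfAlgebra (k H : Type*) [Field k] [Ring H] [Algebra k H]
    extends QuasiBialgebra k H where
  /-- The antipode. -/
  S : H ≃ₗ[k] H
  S_mul : ∀ g h : H, S (g * h) = S h * S g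
  S_one : S 1 = 1
  alpha : H
  beta : H
  /-- `S(h₁) α h₂ = ε(h) α`. -/
  antipode_alpha : ∀ h : H,
    sandwich S.toLinearMap alpha LinearMap.id (comul h) = counit h • alpha
  /-- `h₁ β S(h₂) = ε(h) β`. -/
  antipode_beta : ∀ h : H,
    sandwich LinearMap.id beta S.toLinearMap (comul h) = counit h • beta
  /-- `X¹ β S(X²) α X³ = 1`, where `Φ = X¹ ⊗ X² ⊗ X³`. -/
  antipode_Phi :
    sandwich LinearMap.id beta (sandwich S.toLinearMap alpha LinearMap.id) Phi.val = 1
  /-- `S(x¹) α x² β S(x³) = 1`, where `Φ⁻¹ = x¹ ⊗ x² ⊗ x³`. -/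
  antipode_Phi_inv :
    sandwich S.toLinearMap alpha (sandwich LinearMap.id beta S.toLinearMap) (Phi⁻¹).val = 1

/-- A right comodule algebra structure `(ρ, Φ_ρ)` over the quasi-bialgebra `H` on the
associative unital `k`-algebra `B`. -/
structure RightComoduleAlgebra {k H : Type*} [Field k] [Ring H] [Algebra k H]
    (Q : QuasiBialgebra k H) (B : Type*) [Ring B] [Algebra k B] where
  /-- The coaction `ρ`. -/
  rho : B →ₐ[k] B ⊗[k] H
  /-- The element `Φ_ρ`. -/
  PhiRho : (B ⊗[k] (H ⊗[k] H))ˣ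
  /-- `Φ_ρ (ρ ⊗ id)(ρ(b)) = (id ⊗ Δ)(ρ(b)) Φ_ρ`. -/
  quasi_coassoc : ∀ b : B,
    PhiRho.val * mapLeft rho (rho b) = mapRight Q.comul (rho b) * PhiRho.val
  /-- `(1 ⊗ Φ)(id ⊗ Δ ⊗ id)(Φ_ρ)(Φ_ρ ⊗ 1) = (id ⊗ id ⊗ Δ)(Φ_ρ)(ρ ⊗ id ⊗ id)(Φ_ρ)`. -/
  pentagon :
    ((1 : B) ⊗ₜ[k] Q.Phi.val) * mapRight (mapLeft Q.comul) PhiRho.val *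
        mapRight (mapRight Algebra.TensorProduct.includeLeft) PhiRho.val =
      mapRight (mapRight Q.comul) PhiRho.val * mapLeft rho PhiRho.val
  /-- `(id ⊗ ε) ∘ ρ = id`. -/
  counit_rho : ∀ b : B, mapRight Q.counit (rho b) = b ⊗ₜ[k] (1 : k)
  /-- `(id ⊗ ε ⊗ id)(Φ_ρ) = 1 ⊗ 1`. -/
  counit_PhiRho_mid :
    mapRight (Algebra.TensorProduct.map Q.counit (AlgHom.id k H)) PhiRho.val =
      (1 : B ⊗[k] (k ⊗[k] H))
  /-- `(id ⊗ id ⊗ ε)(Φ_ρ) = 1 ⊗ 1`. -/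
  counit_PhiRho_right :
    mapRight (mapRight Q.counit) PhiRho.val = (1 : B ⊗[k] (H ⊗[k] k))

/-- The identity `(id ⊗ id ⊗ ε)(Φ) = 1`, which follows from the axioms. -/
theorem QuasiBialgebra.counit_Phi_right {k H : Type*} [Field k] [Ring H] [Algebra k H]
    (Q : QuasiBialgebra k H) :
    mapRight (mapRight Q.counit) Q.Phi.val = (1 : H ⊗[k] (H ⊗[k] k)) := by
  -- apply `id ⊗ id ⊗ ε ⊗ ε` to the pentagon identity
  let ee : H ⊗[k] H →ₐ[k] k :=
    (Algebra.TensorProduct.lmul' k).comp (Algebra.TensorProduct.map Q.counit Q.counit)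
  let G : H ⊗[k] (H ⊗[k] (H ⊗[k] H)) →ₐ[k] H ⊗[k] (H ⊗[k] k) := mapRight (mapRight ee)
  let W : H ⊗[k] (H ⊗[k] H) →ₐ[k] H ⊗[k] (H ⊗[k] k) := mapRight (mapRight Q.counit)
  let C : H ⊗[k] (H ⊗[k] H) →ₐ[k] H ⊗[k] (k ⊗[k] H) :=
    mapRight (Algebra.TensorProduct.map Q.counit (AlgHom.id k H))
  have hC : C Q.Phi.val = 1 := Q.counit_Phi
  have hee : ee.comp Q.comul = Q.counit := by
    have hf : ee = (Q.counit.comp (Algebra.TensorProduct.rid k k H).toAlgHom).comp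
        (mapRight Q.counit) := by
      ext x <;> simp [ee, mapRight]
    ext h
    rw [hf]
    simp [Q.counit_right]
  -- `(id ⊗ ε ⊗ ε)(Φ) = 1`
  have h1 : mapRight ee Q.Phi.val = (1 : H ⊗[k] k) := by
    have : mapRight ee =
        (mapRight ((Algebra.TensorProduct.lmul' k).comp
          (mapRight Q.counit))).comp C := by
      ext x <;> simp [ee, mapRight, C]
    rw [this, AlgHom.comp_apply, hC, map_one]
  have e1 : G ((1 : H) ⊗ₜ[k] Q.Phi.val) = 1 := by
    simp only [G, mapRight, Algebra.TensorProduct.map_tmul, AlgHom.coe_id, id_eq]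
    have h1' := h1
    simp only [mapRight] at h1'
    rw [h1']
    rfl
  have e2 : G (mapRight (mapLeft Q.comul) Q.Phi.val) = W Q.Phi.val := by
    have : (mapRight ee).comp (mapLeft Q.comul) = (mapRight Q.counit : H ⊗[k] H →ₐ[k] _) := by
      refine Algebra.TensorProduct.ext' fun g h => ?_
      have aux : ∀ z : H ⊗[k] H, mapRight ee (Algebra.TensorProduct.assoc k k k H H H (z ⊗ₜ h)) =
          Q.counit h • mapRight Q.counit z := by
        intro z
        induction z with
        | zero => simp
        | tmul x y =>
          simp [mapRight, ee, ← TensorProduct.tmul_smul, mul_comm]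
        | add x y hx hy => simp only [TensorProduct.add_tmul, map_add, hx, hy, smul_add]
      have h2 := aux (Q.comul g)
      rw [Q.counit_right g] at h2
      have h3 : ((mapRight ee).comp (mapLeft Q.comul)) (g ⊗ₜ[k] h) =
        mapRight ee (Algebra.TensorProduct.assoc k k k H H H (Q.comul g ⊗ₜ h)) := by
        simp [mapLeft]
      rw [h3, h2, ← TensorProduct.tmul_smul]
      simp [mapRight]
    rw [← AlgHom.comp_apply]
    congr 1
    simp only [G, W, ← this]
    simp only [mapRight, ← Algebra.TensorProduct.map_comp, AlgHom.comp_id]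
  have e3 : G (mapRight (mapRight Algebra.TensorProduct.includeLeft) Q.Phi.val)
      = W Q.Phi.val := by
    have : (ee.comp Algebra.TensorProduct.includeLeft : H →ₐ[k] k) = Q.counit := by
      ext x; simp [ee]
    rw [← AlgHom.comp_apply]
    congr 1
    ext x <;> simp [G, W, mapRight, ee]
  have e4 : G (mapRight (mapRight Q.comul) Q.Phi.val) = W Q.Phi.val := by
    rw [← AlgHom.comp_apply]
    congr 1
    simp only [G, W, mapRight, ← Algebra.TensorProduct.map_comp, AlgHom.comp_id, hee]
  have e5 : G (mapLeft Q.comul Q.Phi.val) = 1 := by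
    have : G.comp (mapLeft Q.comul) = (mapLeft Q.comul).comp (mapRight ee) := by
      refine Algebra.TensorProduct.ext' fun g h => ?_
      simp only [AlgHom.comp_apply, mapLeft, mapRight, Algebra.TensorProduct.map_tmul,
        AlgHom.coe_id, id_eq, G]
      generalize Q.comul g = z
      induction z with
      | zero => simp
      | tmul x y => simp
      | add x y hx hy => simp only [TensorProduct.add_tmul, map_add, hx, hy]
    rw [← AlgHom.comp_apply, this, AlgHom.comp_apply, h1, map_one]
  have key := congrArg G Q.pentagon
  rw [map_mul, map_mul, map_mul, e1, e2, e3, e4, e5] at key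
  have hu : IsUnit (W Q.Phi.val) := (Q.Phi.map W.toRingHom.toMonoidHom).isUnit
  refine hu.mul_left_cancel (?_ : W Q.Phi.val * W Q.Phi.val = W Q.Phi.val * 1)
  rw [one_mul] at key
  exact key

/-- `H` itself is a right `H`-comodule algebra, with `ρ = Δ` and `Φ_ρ = Φ`. -/
def RightComoduleAlgebra.regular {k H : Type*} [Field k] [Ring H] [Algebra k H]
    (Q : QuasiBialgebra k H) : RightComoduleAlgebra Q H where
  rho := Q.comul
  PhiRho := Q.Phi
  quasi_coassoc h := by
    rw [Q.quasi_coassoc h, mul_assoc _ _ Q.Phi.val, Units.inv_mul, mul_one]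
  pentagon := Q.pentagon
  counit_rho := Q.counit_right
  counit_PhiRho_mid := Q.counit_Phi
  counit_PhiRho_right := Q.counit_Phi_right

/-- An algebra map `f : B → B'` is a morphism of right `H`-comodule algebras if
`ρ' ∘ f = (f ⊗ id) ∘ ρ` and `Φ_ρ' = (f ⊗ id ⊗ id)(Φ_ρ)`. -/
structure IsComoduleAlgebraHom {k H B B' : Type*} [Field k] [Ring H] [Algebra k H]
    {Q : QuasiBialgebra k H} [Ring B] [Algebra k B] [Ring B'] [Algebra k B']
    (R : RightComoduleAlgebra Q B) (R' : RightComoduleAlgebra Q B') (f : B →ₐ[k] B') :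
    Prop where
  rho_comp : ∀ b : B, R'.rho (f b) = Algebra.TensorProduct.map f (AlgHom.id k H) (R.rho b)
  map_PhiRho : R'.PhiRho.val =
    Algebra.TensorProduct.map f (AlgHom.id k (H ⊗[k] H)) R.PhiRho.val

/-- The operations of a left `H`-module algebra on a vector space `A`: an action of `H`, a
multiplication and a unit element. No law beyond bilinearity is imposed here; the laws are
`ModuleAlgebraData.IsModuleAlgebra`. -/
structure ModuleAlgebraData (k H A : Type*) [Field k] [Ring H] [Algebra k H]
    [AddCommGroup A] [Module k A] where
  act : H →ₗ[k] A →ₗ[k] A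
  mul : A →ₗ[k] A →ₗ[k] A
  one : A

namespace ModuleAlgebraData

/-- The linear map `m ⊗ n ↦ f(m) g(n)`, the product being that of `D`. -/
def prod {k H A M N : Type*} [Field k] [Ring H] [Algebra k H] [AddCommGroup A] [Module k A]
    [AddCommGroup M] [Module k M] [AddCommGroup N] [Module k N]
    (D : ModuleAlgebraData k H A) (f : M →ₗ[k] A) (g : N →ₗ[k] A) : M ⊗[k] N →ₗ[k] A :=
  TensorProduct.lift D.mul ∘ₗ TensorProduct.map f g

/-- The laws of a left module algebra over the quasi-bialgebra `H`, i.e. of an algebra in the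
monoidal category of left `H`-modules. -/
structure IsModuleAlgebra {k H A : Type*} [Field k] [Ring H] [Algebra k H]
    [AddCommGroup A] [Module k A] (Q : QuasiBialgebra k H) (D : ModuleAlgebraData k H A) :
    Prop where
  one_act : ∀ a, D.act 1 a = a
  mul_act : ∀ g h a, D.act (g * h) a = D.act g (D.act h a)
  one_mul : ∀ a, D.mul D.one a = a
  mul_one : ∀ a, D.mul a D.one = a
  /-- `(a a') a'' = (X¹ · a) ((X² · a') (X³ · a''))`. -/
  quasi_assoc : ∀ a a' a'', D.mul (D.mul a a') a'' =
    D.prod (D.act.flip a) (D.prod (D.act.flip a') (D.act.flip a'')) Q.Phi.val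
  /-- `h · (a a') = (h₁ · a) (h₂ · a')`. -/
  act_mul : ∀ h a a', D.act h (D.mul a a') =
    D.prod (D.act.flip a) (D.act.flip a') (Q.comul h)
  /-- `h · 1 = ε(h) 1`. -/
  act_one : ∀ h, D.act h D.one = Q.counit h • D.one

/-- A linear map is a morphism of left `H`-module algebras if it is multiplicative, unital and
`H`-linear. -/
structure IsHom {k H A A' : Type*} [Field k] [Ring H] [Algebra k H]
    [AddCommGroup A] [Module k A] [AddCommGroup A'] [Module k A']
    (D : ModuleAlgebraData k H A) (D' : ModuleAlgebraData k H A') (f : A →ₗ[k] A') :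
    Prop where
  map_mul : ∀ a a', f (D.mul a a') = D'.mul (f a) (f a')
  map_one : f D.one = D'.one
  map_act : ∀ h a, f (D.act h a) = D'.act h (f a)

end ModuleAlgebraData

namespace QuasiHopfAlgebra

/-- `p_R = p¹ ⊗ p² = x¹ ⊗ x² β S(x³)`. -/
def pR {k H : Type*} [Field k] [Ring H] [Algebra k H] (Q : QuasiHopfAlgebra k H) : H ⊗[k] H :=
  TensorProduct.map LinearMap.id (sandwich LinearMap.id Q.beta Q.S.toLinearMap) (Q.Phi⁻¹).val

/-- `q_R = q¹ ⊗ q² = X¹ ⊗ S⁻¹(α X³) X²`. -/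
def qR {k H : Type*} [Field k] [Ring H] [Algebra k H] (Q : QuasiHopfAlgebra k H) : H ⊗[k] H :=
  TensorProduct.map LinearMap.id
    (sandwich (Q.S.symm.toLinearMap ∘ₗ LinearMap.mulLeft k Q.alpha) 1 LinearMap.id ∘ₗ
      (TensorProduct.comm k H H).toLinearMap) Q.Phi.val

/-- `q¹ β S(q²) = 1`. -/
theorem qR_beta {k H : Type*} [Field k] [Ring H] [Algebra k H] (Q : QuasiHopfAlgebra k H) :
    sandwich LinearMap.id Q.beta Q.S.toLinearMap Q.qR = 1 := by
  rw [← Q.antipode_Phi, qR, ← LinearMap.comp_apply]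
  congr 1
  ext x y z
  simp [Q.S_mul, mul_assoc]

/-- The module algebra `B^v`, for an algebra map `v : H → B`: the vector space `B` with
* action `h ▷_v b = v(h₁) b v(S(h₂))`,
* multiplication `b ∘ b' = v(X¹) b v(S(x¹X²) α x²X³₁) b' v(S(x³X³₂))`; note that
  `X¹ ⊗ x¹X² ⊗ x²X³₁ ⊗ x³X³₂ = (1 ⊗ Φ⁻¹)(id ⊗ id ⊗ Δ)(Φ)`,
* unit `v(β)`. -/
def twist {k H B : Type*} [Field k] [Ring H] [Algebra k H] [Ring B] [Algebra k B]
    (Q : QuasiHopfAlgebra k H) (v : H →ₐ[k] B) : ModuleAlgebraData k H B where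
  act := LinearMap.mk₂ k
    (fun h b => sandwich v.toLinearMap b (v.toLinearMap ∘ₗ Q.S.toLinearMap) (Q.comul h))
    (fun _ _ _ => by simp only [map_add]) (fun _ _ _ => by simp only [map_smul])
    (fun _ _ _ => by simp only [sandwich_add, LinearMap.add_apply])
    (fun _ _ _ => by simp only [sandwich_smul, LinearMap.smul_apply])
  mul := LinearMap.mk₂ k
    (fun b b' =>
      sandwich v.toLinearMap b
        (sandwich (v.toLinearMap ∘ₗ Q.S.toLinearMap) (v Q.alpha)
          (sandwich v.toLinearMap b' (v.toLinearMap ∘ₗ Q.S.toLinearMap)))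
        (((1 : H) ⊗ₜ[k] (Q.Phi⁻¹).val) * mapRight (mapRight Q.comul) Q.Phi.val))
    (fun _ _ _ => by simp only [sandwich_add, LinearMap.add_apply])
    (fun _ _ _ => by simp only [sandwich_smul, LinearMap.smul_apply])
    (fun _ _ _ => by simp only [sandwich_add, sandwich_add_right, LinearMap.add_apply])
    (fun _ _ _ => by simp only [sandwich_smul, sandwich_smul_right, LinearMap.smul_apply])
  one := v Q.beta

/-- The map `E : B → B`, `E(b) = v(q¹) b₍₀₎ v(β S(q² b₍₁₎))`. -/
def E {k H B : Type*} [Field k] [Ring H] [Algebra k H] [Ring B] [Algebra k B]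
    (Q : QuasiHopfAlgebra k H) (R : RightComoduleAlgebra Q.toQuasiBialgebra B)
    (v : H →ₐ[k] B) : B →ₗ[k] B :=
  sandwich LinearMap.id (v Q.beta) (v.toLinearMap ∘ₗ Q.S.toLinearMap) ∘ₗ
    LinearMap.mulLeft k (Algebra.TensorProduct.map v (AlgHom.id k H) Q.qR) ∘ₗ
      R.rho.toLinearMap

theorem E_one {k H B : Type*} [Field k] [Ring H] [Algebra k H] [Ring B] [Algebra k B]
    (Q : QuasiHopfAlgebra k H) (R : RightComoduleAlgebra Q.toQuasiBialgebra B)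
    (v : H →ₐ[k] B) : Q.E R v 1 = 1 := by
  have h : sandwich LinearMap.id (v Q.beta) (v.toLinearMap ∘ₗ Q.S.toLinearMap) ∘ₗ
      (Algebra.TensorProduct.map v (AlgHom.id k H)).toLinearMap =
      v.toLinearMap ∘ₗ sandwich LinearMap.id Q.beta Q.S.toLinearMap := by
    ext x y
    simp
  have h' := LinearMap.congr_fun h Q.qR
  rw [LinearMap.comp_apply, LinearMap.comp_apply, Q.qR_beta] at h'
  simp only [E, LinearMap.comp_apply, AlgHom.toLinearMap_apply, map_one,
    LinearMap.mulLeft_apply, mul_one] at h' ⊢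
  exact h'

/-- The coinvariants `A = B^{co(H)} = E(B)`. -/
abbrev coinv {k H B : Type*} [Field k] [Ring H] [Algebra k H] [Ring B] [Algebra k B]
    (Q : QuasiHopfAlgebra k H) (R : RightComoduleAlgebra Q.toQuasiBialgebra B)
    (v : H →ₐ[k] B) : Submodule k B :=
  LinearMap.range (Q.E R v)

/-- The operations on `A = B^{co(H)}`: action `h ▷ a = E(v(h) a)`, multiplication
`a * a' = E(a a')`, and the unit `1` of `B`. -/
def coinvData {k H B : Type*} [Field k] [Ring H] [Algebra k H] [Ring B] [Algebra k B]
    (Q : QuasiHopfAlgebra k H) (R : RightComoduleAlgebra Q.toQuasiBialgebra B)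
    (v : H →ₐ[k] B) : ModuleAlgebraData k H (Q.coinv R v) where
  act := ((LinearMap.mul k B).compl₁₂ v.toLinearMap (Q.coinv R v).subtype).compr₂
    (Q.E R v).rangeRestrict
  mul := ((LinearMap.mul k B).compl₁₂ (Q.coinv R v).subtype (Q.coinv R v).subtype).compr₂
    (Q.E R v).rangeRestrict
  one := ⟨1, 1, Q.E_one R v⟩

/-- The map `θ : A → B^v`, `θ(a) = (p¹ ▷ a) v(p²)`. -/
def theta {k H B : Type*} [Field k] [Ring H] [Algebra k H] [Ring B] [Algebra k B]
    (Q : QuasiHopfAlgebra k H) (R : RightComoduleAlgebra Q.toQuasiBialgebra B)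
    (v : H →ₐ[k] B) : Q.coinv R v →ₗ[k] B where
  toFun a := sandwich ((Q.coinv R v).subtype ∘ₗ (Q.coinvData R v).act.flip a) 1
    v.toLinearMap Q.pR
  map_add' a a' := by
    simp only [map_add, sandwich, LinearMap.comp_add, TensorProduct.map_add_left,
      LinearMap.add_apply, LinearMap.comp_apply]
  map_smul' c a := by
    simp only [map_smul, sandwich, LinearMap.comp_smul, TensorProduct.map_smul_left,
      LinearMap.smul_apply, LinearMap.comp_apply, RingHom.id_apply]

end QuasiHopfAlgebra

end

end QuasiHopf

open scoped TensorProduct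

namespace QuasiHopf

section

attribute [-instance] Algebra.TensorProduct.instMul Algebra.TensorProduct.instOneTensorProduct

/-! Write `v` silently and let Ψ(b) = X¹ b S(X²) α X³ (`untwist`), χ(b) = b₍₀₎ β S(b₍₁₎)
(`cotwist`). Everything rests on these two maps.

For B^v, quasi-coassociativity gives Ψ(h₁ ▷ b) h₂ = h Ψ(b) (`untwist_act`), and one form of the
pentagon rewrites the product as b ∘ b' = Ψ(x¹ ▷ b) x² b' S(x³) (`twist_mul`). A second form gives
Ψ(b ∘ b') = Ψ(X¹ ▷ b) Ψ(X² ▷ b') X³ (`untwist_mul`), and a third then yields associativity up to Φ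
(`twist_assoc`).

For A, one has E = Ψ ∘ χ, with χ(b h) = ε(h) χ(b) and χ(h b) = h ▷ χ(b). Moreover E(b₍₀₎) b₍₁₎ = b
(`E_rho`); applying χ gives χ ∘ E = χ, so E is a projection onto A. The formula ρ(E(b)) = E(x¹ b) x²
⊗ x³ (`rho_E`) shows that θ is the restriction of χ to A, and with `twist_mul` it gives χ(b) ∘ χ(b')
= χ(E(b) b'). Hence θ is a morphism. It is injective because Ψ ∘ θ is the inclusion of A in B, and
the laws of A are pulled back from B^v along θ.

All identities are additive in their tensors, so they are checked on pure tensors. The coproduct of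
an element is first replaced by an arbitrary tensor `d`, and the antipode axioms are applied only
after specialising back. -/

/-! ### Induction on pure tensors and elementary maps of tensor products. -/

theorem tensor2_induction {k M N : Type*} [Field k] [AddCommGroup M] [Module k M]
    [AddCommGroup N] [Module k N] {p : M ⊗[k] N → Prop}
    (tmul : ∀ x y, p (x ⊗ₜ y)) (add : ∀ a b, p a → p b → p (a + b)) (t : M ⊗[k] N) : p t := by
  induction t with
  | zero => simpa using tmul 0 0
  | tmul x y => exact tmul x y
  | add a b ha hb => exact add a b ha hb

theorem tensor3_induction {k M N P : Type*} [Field k] [AddCommGroup M] [Module k M]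
    [AddCommGroup N] [Module k N] [AddCommGroup P] [Module k P] {p : M ⊗[k] (N ⊗[k] P) → Prop}
    (tmul : ∀ x y z, p (x ⊗ₜ (y ⊗ₜ z))) (add : ∀ a b, p a → p b → p (a + b))
    (t : M ⊗[k] (N ⊗[k] P)) : p t := by
  refine tensor2_induction (fun x s => ?_) add t
  induction s using tensor2_induction with
  | tmul y z => exact tmul x y z
  | add a b ha hb => rw [TensorProduct.tmul_add]; exact add _ _ ha hb

theorem tensor4_induction {k M N P R : Type*} [Field k] [AddCommGroup M] [Module k M]
    [AddCommGroup N] [Module k N] [AddCommGroup P] [Module k P] [AddCommGroup R] [Module k R]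
    {p : M ⊗[k] (N ⊗[k] (P ⊗[k] R)) → Prop}
    (tmul : ∀ x y z w, p (x ⊗ₜ (y ⊗ₜ (z ⊗ₜ w)))) (add : ∀ a b, p a → p b → p (a + b))
    (t : M ⊗[k] (N ⊗[k] (P ⊗[k] R))) : p t := by
  refine tensor2_induction (fun x s => ?_) add t
  induction s using tensor3_induction with
  | tmul y z w => exact tmul x y z w
  | add a b ha hb => rw [TensorProduct.tmul_add]; exact add _ _ ha hb

/-- The product here is the one coming from the ring structure, the form in which it occurs in all
statements below. -/
theorem tmul_mul_tmul {k M N : Type*} [Field k] [Ring M] [Algebra k M] [Ring N] [Algebra k N]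
    (a c : M) (b d : N) : (a ⊗ₜ[k] b) * (c ⊗ₜ[k] d) = (a * c) ⊗ₜ[k] (b * d) :=
  Algebra.TensorProduct.tmul_mul_tmul a c b d

theorem algHom_map_one {k M N : Type*} [Field k] [Ring M] [Algebra k M] [Ring N] [Algebra k N]
    (f : M →ₐ[k] N) : f 1 = 1 := map_one f

section Maps

variable {k M N P H : Type*} [Field k] [Ring M] [Algebra k M] [Ring N] [Algebra k N]
  [Ring P] [Algebra k P] [Ring H] [Algebra k H]

theorem mapRight_tmul (g : N →ₐ[k] P) (m : M) (n : N) :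
    mapRight g (m ⊗ₜ[k] n) = m ⊗ₜ[k] g n := by
  simp [mapRight]

theorem mapLeft_tmul (f : M →ₐ[k] P ⊗[k] H) (m : M) (n : N) :
    mapLeft f (m ⊗ₜ[k] n) = TensorProduct.assoc k P H N (f m ⊗ₜ n) := by
  simp [mapLeft]
  rfl

/-- `ε ⊗ id`, as a map to the second factor. -/
def contractLeft (e : M →ₐ[k] k) : M ⊗[k] N →ₐ[k] N :=
  (Algebra.TensorProduct.lid k N).toAlgHom.comp (Algebra.TensorProduct.map e (AlgHom.id k N))

theorem contractLeft_tmul (e : M →ₐ[k] k) (m : M) (n : N) :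
    contractLeft e (m ⊗ₜ[k] n) = e m • n := by
  simp [contractLeft]

/-- `id ⊗ ε`, as a map to the first factor. -/
def contractRight (e : N →ₐ[k] k) : M ⊗[k] N →ₐ[k] M :=
  (Algebra.TensorProduct.rid k k M).toAlgHom.comp (mapRight e)

theorem contractRight_tmul (e : N →ₐ[k] k) (m : M) (n : N) :
    contractRight e (m ⊗ₜ[k] n) = e n • m := by
  simp [contractRight, mapRight]

end Maps

/-! ### Counit normalisations of Φ and rearrangements of the pentagon. -/

namespace QuasiBialgebra

variable {k H : Type*} [Field k] [Ring H] [Algebra k H] (Q : QuasiBialgebra k H)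

theorem contractRight_comul (h : H) : contractRight Q.counit (Q.comul h) = h := by
  simp [contractRight, Q.counit_right]

theorem contractLeft_comul (h : H) : contractLeft Q.counit (Q.comul h) = h := by
  simp [contractLeft, Q.counit_left]

theorem map_Phi_inv {A : Type*} [Ring A] [Algebra k A]
    (f : H ⊗[k] (H ⊗[k] H) →ₐ[k] A) : f Q.Phi.val = 1 → f (Q.Phi⁻¹).val = 1 := by
  intro h
  have h1 := congrArg f (Units.mul_inv Q.Phi)
  rwa [map_mul, h, one_mul, map_one] at h1

theorem contract_mid_Phi : mapRight (contractLeft Q.counit) Q.Phi.val = (1 : H ⊗[k] H) := by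
  have h : (mapRight (contractLeft Q.counit) : H ⊗[k] (H ⊗[k] H) →ₐ[k] _) =
      (mapRight (Algebra.TensorProduct.lid k H).toAlgHom).comp
        (mapRight (Algebra.TensorProduct.map Q.counit (AlgHom.id k H))) := by
    ext x <;> simp [mapRight, contractLeft]
  rw [h, AlgHom.comp_apply, Q.counit_Phi, map_one]

theorem contract_right_Phi : mapRight (contractRight Q.counit) Q.Phi.val = (1 : H ⊗[k] H) := by
  have h : (mapRight (contractRight Q.counit) : H ⊗[k] (H ⊗[k] H) →ₐ[k] _) =
      (mapRight (Algebra.TensorProduct.rid k k H).toAlgHom).comp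
        (mapRight (mapRight Q.counit)) := by
    ext x <;> simp [mapRight, contractRight]
  rw [h, AlgHom.comp_apply, Q.counit_Phi_right, map_one]

/-- `(ε ⊗ ε ⊗ id)(Φ) = 1`. -/
theorem contract_left_mid_Phi :
    contractLeft Q.counit (mapRight (contractLeft Q.counit) Q.Phi.val) = 1 := by
  rw [contract_mid_Phi, map_one]

/-- `(ε ⊗ id ⊗ id)(Φ) = 1`. -/
theorem contract_left_Phi : contractLeft Q.counit Q.Phi.val = (1 : H ⊗[k] H) := by
  let W : H ⊗[k] (H ⊗[k] H) →ₐ[k] H ⊗[k] H := contractLeft Q.counit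
  let V : H ⊗[k] (H ⊗[k] H) →ₐ[k] H :=
    (contractLeft Q.counit).comp (mapRight (contractLeft Q.counit))
  have hV : V Q.Phi.val = 1 := Q.contract_left_mid_Phi
  -- Apply ε ⊗ ε ⊗ id ⊗ id to the pentagon: with W = (ε ⊗ id ⊗ id)(Φ) it becomes W · W = W, and W is
  -- invertible.
  let G : H ⊗[k] (H ⊗[k] (H ⊗[k] H)) →ₐ[k] H ⊗[k] H :=
    (contractLeft Q.counit).comp (contractLeft Q.counit)
  have e1 : G ((1 : H) ⊗ₜ[k] Q.Phi.val) = W Q.Phi.val := by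
    simp only [G, AlgHom.comp_apply, contractLeft_tmul, map_one, one_smul, W]
  have e2 (Z) : G (mapRight (mapLeft Q.comul) Z) = W Z := by
    induction Z using tensor3_induction with
    | add a b ha hb => simp only [map_add, ha, hb]
    | tmul x y z =>
      have aux (d : H ⊗[k] H) : contractLeft Q.counit (TensorProduct.assoc k H H H (d ⊗ₜ z)) =
          contractLeft Q.counit d ⊗ₜ z := by
        induction d using tensor2_induction with
        | add a b ha hb => simp only [map_add, TensorProduct.add_tmul, ha, hb]
        | tmul a b => simp [contractLeft_tmul, TensorProduct.smul_tmul']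
      simp [G, W, mapRight_tmul, mapLeft_tmul, contractLeft_tmul, aux, Q.contractLeft_comul]
  have e3 (Z) : G (mapRight (mapRight Algebra.TensorProduct.includeLeft) Z) = V Z ⊗ₜ 1 := by
    induction Z using tensor3_induction with
    | add a b ha hb => simp only [map_add, TensorProduct.add_tmul, ha, hb]
    | tmul x y z =>
      simp [G, V, mapRight_tmul, contractLeft_tmul, TensorProduct.smul_tmul', mul_comm]
  have e4 (Z) : G (mapRight (mapRight Q.comul) Z) = Q.comul (V Z) := by
    induction Z using tensor3_induction with
    | add a b ha hb => simp only [map_add, ha, hb]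
    | tmul x y z => simp [G, V, mapRight_tmul, contractLeft_tmul, smul_comm (Q.counit x)]
  have e5 (Z) : G (mapLeft Q.comul Z) = W Z := by
    induction Z using tensor3_induction with
    | add a b ha hb => simp only [map_add, ha, hb]
    | tmul x y z =>
      have aux (d : H ⊗[k] H) : G (TensorProduct.assoc k H H (H ⊗[k] H) (d ⊗ₜ (y ⊗ₜ z))) =
          Q.counit (contractLeft Q.counit d) • (y ⊗ₜ z) := by
        induction d using tensor2_induction with
        | add a b ha hb => simp only [map_add, TensorProduct.add_tmul, ha, hb, add_smul]
        | tmul a b => simp [G, contractLeft_tmul, mul_smul]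
      rw [mapLeft_tmul, aux, Q.contractLeft_comul, contractLeft_tmul]
  have key := congrArg G Q.pentagon
  rw [map_mul, map_mul, map_mul, e1, e2, e3, e4, e5, hV, map_one, one_mul] at key
  have hu : IsUnit (W Q.Phi.val) := (Q.Phi.map W.toRingHom.toMonoidHom).isUnit
  refine hu.mul_left_cancel (?_ : W Q.Phi.val * W Q.Phi.val = W Q.Phi.val * 1)
  rw [mul_one]
  exact (mul_one (W Q.Phi.val * W Q.Phi.val)).symm.trans key

section

variable {A : Type*} [Ring A] [Algebra k A] (f : H ⊗[k] (H ⊗[k] H) →ₐ[k] A)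

theorem map_Phi_mul_inv : f Q.Phi.val * f (Q.Phi⁻¹).val = 1 := by
  rw [← map_mul, Units.mul_inv, map_one]

theorem map_Phi_inv_mul : f (Q.Phi⁻¹).val * f Q.Phi.val = 1 := by
  rw [← map_mul, Units.inv_mul, map_one]

end

/-- `Φ (Δ ⊗ id)(Δ(h)) = (id ⊗ Δ)(Δ(h)) Φ`. -/
theorem Phi_mul_comul (h : H) :
    Q.Phi.val * mapLeft Q.comul (Q.comul h) = mapRight Q.comul (Q.comul h) * Q.Phi.val := by
  rw [Q.quasi_coassoc, mul_assoc _ _ Q.Phi.val, Units.inv_mul, mul_one]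

/-- `(Δ ⊗ id)(Δ(h)) Φ⁻¹ = Φ⁻¹ (id ⊗ Δ)(Δ(h))`. -/
theorem comul_mul_Phi_inv (h : H) :
    mapLeft Q.comul (Q.comul h) * (Q.Phi⁻¹).val = (Q.Phi⁻¹).val * mapRight Q.comul (Q.comul h) := by
  rw [Q.quasi_coassoc, mul_assoc, Units.inv_mul_cancel_left]

/-- `(1 ⊗ Φ⁻¹)(id ⊗ id ⊗ Δ)(Φ) = (id ⊗ Δ ⊗ id)(Φ)(Φ ⊗ 1)(Δ ⊗ id ⊗ id)(Φ⁻¹)`. -/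
theorem pentagon_mid :
    ((1 : H) ⊗ₜ[k] (Q.Phi⁻¹).val) * mapRight (mapRight Q.comul) Q.Phi.val =
      mapRight (mapLeft Q.comul) Q.Phi.val *
        (mapRight (mapRight Algebra.TensorProduct.includeLeft) Q.Phi.val *
          mapLeft Q.comul (Q.Phi⁻¹).val) := by
  have h1 : ((1 : H) ⊗ₜ[k] (Q.Phi⁻¹).val) * ((1 : H) ⊗ₜ[k] Q.Phi.val) = 1 :=
    Q.map_Phi_inv_mul
      (Algebra.TensorProduct.includeRight : _ →ₐ[k] H ⊗[k] (H ⊗[k] (H ⊗[k] H)))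
  have h2 := Q.map_Phi_mul_inv (mapLeft Q.comul : _ →ₐ[k] H ⊗[k] (H ⊗[k] (H ⊗[k] H)))
  have h := congrArg (fun t => ((1 : H) ⊗ₜ[k] (Q.Phi⁻¹).val) * t * mapLeft Q.comul (Q.Phi⁻¹).val)
    Q.pentagon
  simp only [mul_assoc] at h
  rw [h2, mul_one] at h
  rw [← h, ← mul_assoc, h1, one_mul]

/-- `(Δ ⊗ id ⊗ id)(Φ)(Φ⁻¹ ⊗ 1) = (id ⊗ id ⊗ Δ)(Φ⁻¹)(1 ⊗ Φ)(id ⊗ Δ ⊗ id)(Φ)`. -/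
theorem pentagon_left :
    mapLeft Q.comul Q.Phi.val *
        mapRight (mapRight Algebra.TensorProduct.includeLeft) (Q.Phi⁻¹).val =
      mapRight (mapRight Q.comul) (Q.Phi⁻¹).val *
        (((1 : H) ⊗ₜ[k] Q.Phi.val) * mapRight (mapLeft Q.comul) Q.Phi.val) := by
  have h1 := Q.map_Phi_inv_mul (mapRight (mapRight Q.comul) : _ →ₐ[k] H ⊗[k] (H ⊗[k] (H ⊗[k] H)))
  have h2 := Q.map_Phi_mul_inv (mapRight (mapRight Algebra.TensorProduct.includeLeft) :
    _ →ₐ[k] H ⊗[k] (H ⊗[k] (H ⊗[k] H)))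
  have h := congrArg (fun t => t *
    mapRight (mapRight Algebra.TensorProduct.includeLeft) (Q.Phi⁻¹).val) Q.pentagon
  rw [mul_assoc _ _ (mapRight (mapRight Algebra.TensorProduct.includeLeft) (Q.Phi⁻¹).val), h2,
    mul_one, mul_assoc] at h
  rw [h, ← mul_assoc, h1, one_mul]

/-- `(Φ ⊗ 1)(Δ ⊗ id ⊗ id)(Φ⁻¹) = (id ⊗ Δ ⊗ id)(Φ⁻¹)(1 ⊗ Φ⁻¹)(id ⊗ id ⊗ Δ)(Φ)`. -/
theorem pentagon_right :
    mapRight (mapRight Algebra.TensorProduct.includeLeft) Q.Phi.val *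
        mapLeft Q.comul (Q.Phi⁻¹).val =
      mapRight (mapLeft Q.comul) (Q.Phi⁻¹).val *
        (((1 : H) ⊗ₜ[k] (Q.Phi⁻¹).val) * mapRight (mapRight Q.comul) Q.Phi.val) := by
  have h1 := Q.map_Phi_inv_mul (mapRight (mapLeft Q.comul) : _ →ₐ[k] H ⊗[k] (H ⊗[k] (H ⊗[k] H)))
  rw [Q.pentagon_mid, ← mul_assoc, h1, one_mul]

end QuasiBialgebra

theorem ModuleAlgebraData.prod_tmul {k H A M N : Type*} [Field k] [Ring H] [Algebra k H]
    [AddCommGroup A] [Module k A] [AddCommGroup M] [Module k M] [AddCommGroup N] [Module k N]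
    (D : ModuleAlgebraData k H A) (f : M →ₗ[k] A) (g : N →ₗ[k] A) (m : M) (n : N) :
    D.prod f g (m ⊗ₜ n) = D.mul (f m) (g n) := by
  simp [prod]

/-! ### The module algebra B^v, studied through Ψ. -/

namespace QuasiHopfAlgebra

variable {k H B : Type*} [Field k] [Ring H] [Algebra k H] [Ring B] [Algebra k B]
  (Q : QuasiHopfAlgebra k H) (v : H →ₐ[k] B)

/-- The map `x ⊗ y ↦ v(x) b v(S(y))`. -/
def adj (b : B) : H ⊗[k] H →ₗ[k] B :=
  sandwich v.toLinearMap b (v.toLinearMap ∘ₗ Q.S.toLinearMap)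

theorem adj_tmul (b : B) (x y : H) : Q.adj v b (x ⊗ₜ y) = v x * b * v (Q.S y) := by
  simp [adj]

theorem twist_act (h : H) (b : B) : (Q.twist v).act h b = Q.adj v b (Q.comul h) := rfl

/-- The map `x ⊗ y ⊗ z ↦ v(x) b v(S(y) α z)`. -/
def antipodeForm (b : B) : H ⊗[k] (H ⊗[k] H) →ₗ[k] B :=
  sandwich v.toLinearMap b
    (sandwich (v.toLinearMap ∘ₗ Q.S.toLinearMap) (v Q.alpha) v.toLinearMap)

theorem antipodeForm_tmul (b : B) (x y z : H) :
    Q.antipodeForm v b (x ⊗ₜ (y ⊗ₜ z)) = v x * b * (v (Q.S y) * v Q.alpha * v z) := by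
  simp [antipodeForm]

/-- The map `b ↦ v(x) b v(S(y) α z)`, for an element `x ⊗ y ⊗ z`. -/
def untwistAt (Z : H ⊗[k] (H ⊗[k] H)) : B →ₗ[k] B where
  toFun b := Q.antipodeForm v b Z
  map_add' b b' := by simp only [antipodeForm, sandwich_add, LinearMap.add_apply]
  map_smul' c b := by
    simp only [antipodeForm, sandwich_smul, LinearMap.smul_apply, RingHom.id_apply]

/-- The map `Ψ(b) = v(X¹) b v(S(X²) α X³)`. -/
def untwist : B →ₗ[k] B := Q.untwistAt v Q.Phi.val

theorem untwistAt_apply (Z) (b : B) : Q.untwistAt v Z b = Q.antipodeForm v b Z := rfl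

theorem untwist_apply (b : B) : Q.untwist v b = Q.antipodeForm v b Q.Phi.val := rfl

/-- `h ↦ Ψ(h ▷ b)`. -/
def untwistAct (b : B) : H →ₗ[k] B := Q.untwist v ∘ₗ (Q.twist v).act.flip b

theorem untwistAct_apply (b : B) (h : H) :
    Q.untwistAct v b h = Q.untwist v ((Q.twist v).act h b) := rfl

theorem map_sandwich_alpha_comul (h : H) (b b' : B) :
    b * sandwich (v.toLinearMap ∘ₗ Q.S.toLinearMap) (v Q.alpha) v.toLinearMap (Q.comul h) * b' =
      Q.counit h • (b * v Q.alpha * b') := by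
  have e (d : H ⊗[k] H) :
      sandwich (v.toLinearMap ∘ₗ Q.S.toLinearMap) (v Q.alpha) v.toLinearMap d =
        v (sandwich Q.S.toLinearMap Q.alpha LinearMap.id d) := by
    induction d using tensor2_induction with
    | tmul x y => simp
    | add a b ha hb => simp only [map_add, ha, hb]
  rw [e, Q.antipode_alpha, map_smul, mul_smul_comm, smul_mul_assoc]

theorem map_sandwich_beta_comul (h : H) :
    sandwich v.toLinearMap (v Q.beta) (v.toLinearMap ∘ₗ Q.S.toLinearMap) (Q.comul h) =
      Q.counit h • v Q.beta := by
  have e (d : H ⊗[k] H) :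
      sandwich v.toLinearMap (v Q.beta) (v.toLinearMap ∘ₗ Q.S.toLinearMap) d =
        v (sandwich LinearMap.id Q.beta Q.S.toLinearMap d) := by
    induction d using tensor2_induction with
    | tmul x y => simp
    | add a b ha hb => simp only [map_add, ha, hb]
  rw [e, Q.antipode_beta, map_smul]

theorem untwist_beta : Q.untwist v (v Q.beta) = 1 := by
  have e (d) : Q.antipodeForm v (v Q.beta) d =
      v (sandwich LinearMap.id Q.beta (sandwich Q.S.toLinearMap Q.alpha LinearMap.id) d) := by
    induction d using tensor3_induction with
    | tmul x y z => simp [antipodeForm_tmul]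
    | add a b ha hb => simp only [map_add, ha, hb]
  rw [untwist_apply, e, Q.antipode_Phi, map_one]

/-- `S` reverses products, so H ⊗ H acts on B by b ↦ v(x) b v(S(y)); composing with Δ gives the
action of B^v. -/
theorem adj_mul (b : B) (d e : H ⊗[k] H) : Q.adj v b (d * e) = Q.adj v (Q.adj v b e) d := by
  have hadd (c c' : B) : Q.adj v (c + c') = Q.adj v c + Q.adj v c' := sandwich_add _ _ _ _
  induction d using tensor2_induction with
  | add a b ha hb => simp only [map_add, add_mul, ha, hb]
  | tmul x y =>
    induction e using tensor2_induction with
    | add a b ha hb => simp only [map_add, mul_add, ha, hb, hadd, LinearMap.add_apply]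
    | tmul z w => simp [adj_tmul, Q.S_mul, mul_assoc]

theorem twist_one_act (b : B) : (Q.twist v).act 1 b = b := by
  rw [twist_act, map_one]
  change Q.adj v b ((1 : H) ⊗ₜ (1 : H)) = b
  simp [adj_tmul, Q.S_one]

theorem twist_mul_act (g h : H) (b : B) :
    (Q.twist v).act (g * h) b = (Q.twist v).act g ((Q.twist v).act h b) := by
  rw [twist_act, map_mul, adj_mul]; rfl

theorem twist_act_one (h : H) : (Q.twist v).act h (v Q.beta) = Q.counit h • v Q.beta :=
  Q.map_sandwich_beta_comul v h

/-- `(id ⊗ Δ)(g ⊗ h)` acts in the second and third factors through the counit. -/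
theorem antipodeForm_comul_mul (b : B) (d : H ⊗[k] H) (Z : H ⊗[k] (H ⊗[k] H)) :
    Q.antipodeForm v b (mapRight Q.comul d * Z) =
      v (contractRight Q.counit d) * Q.antipodeForm v b Z := by
  induction d using tensor2_induction with
  | add a b ha hb => simp only [map_add, add_mul, ha, hb]
  | tmul g h =>
    induction Z using tensor3_induction with
    | add a b ha hb => simp only [map_add, mul_add, ha, hb]
    | tmul x y z =>
      have e (d : H ⊗[k] H) : Q.antipodeForm v b (g ⊗ₜ d * (x ⊗ₜ (y ⊗ₜ z))) =
          v g * v x * b * v (Q.S y) *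
            sandwich (v.toLinearMap ∘ₗ Q.S.toLinearMap) (v Q.alpha) v.toLinearMap d * v z := by
        induction d using tensor2_induction with
        | add a b ha hb => simp only [map_add, TensorProduct.tmul_add, mul_add, add_mul, ha, hb]
        | tmul p q => simp [antipodeForm_tmul, Q.S_mul, mul_assoc]
      -- The coproduct meets α as S(h₁) α h₂ = ε(h) α.
      rw [mapRight_tmul, e, Q.map_sandwich_alpha_comul, contractRight_tmul, antipodeForm_tmul]
      simp [mul_assoc]

/-- On pure tensors this is X¹ g₁ b S(X² g₂) α X³ h = Ψ(g ▷ b) h. It supplies the left side of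
`untwist_act`. -/
theorem antipodeForm_mul_comul (b : B) (d : H ⊗[k] H) :
    Q.antipodeForm v b (Q.Phi.val * mapLeft Q.comul d) =
      sandwich (Q.untwistAct v b) 1 v.toLinearMap d := by
  induction d using tensor2_induction with
  | add a b ha hb => simp only [map_add, mul_add, ha, hb]
  | tmul g h =>
    have hadd (c c' : B) : Q.antipodeForm v (c + c') = Q.antipodeForm v c + Q.antipodeForm v c' :=
      sandwich_add _ _ _ _
    have e (Z) (d : H ⊗[k] H) : Q.antipodeForm v b (Z * TensorProduct.assoc k H H H (d ⊗ₜ h)) =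
        Q.antipodeForm v (Q.adj v b d) Z * v h := by
      induction d using tensor2_induction with
      | add a b ha hb =>
        simp only [map_add, TensorProduct.add_tmul, mul_add, add_mul, ha, hb, hadd,
          LinearMap.add_apply]
      | tmul p q =>
        induction Z using tensor3_induction with
        | add a b ha hb => simp only [map_add, add_mul, ha, hb]
        | tmul x y z =>
          simp [antipodeForm_tmul, adj_tmul, Q.S_mul, mul_assoc]
    rw [mapLeft_tmul, e, sandwich_tmul, mul_one]
    rfl

/-- `Ψ(h₁ ▷ b) h₂ = h Ψ(b)`. -/
theorem untwist_act (b : B) (h : H) :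
    sandwich (Q.untwistAct v b) 1 v.toLinearMap (Q.comul h) = v h * Q.untwist v b := by
  -- Quasi-coassociativity moves the iterated coproduct to the left of Φ, where its last two legs
  -- cancel across α.
  rw [← antipodeForm_mul_comul, Q.Phi_mul_comul, antipodeForm_comul_mul, Q.contractRight_comul]
  rfl

/-- The map `x ⊗ y ⊗ z ⊗ w ↦ v(x) b v(S(y) α z) b' v(S(w))`. -/
def mulForm (b b' : B) : H ⊗[k] (H ⊗[k] (H ⊗[k] H)) →ₗ[k] B :=
  sandwich v.toLinearMap b
    (sandwich (v.toLinearMap ∘ₗ Q.S.toLinearMap) (v Q.alpha) (Q.adj v b'))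

theorem mulForm_tmul (b b' : B) (x y z w : H) : Q.mulForm v b b' (x ⊗ₜ (y ⊗ₜ (z ⊗ₜ w))) =
    v x * b * (v (Q.S y) * v Q.alpha * (v z * b' * v (Q.S w))) := by
  simp [mulForm, adj_tmul]

theorem twist_mul_eq_mulForm (b b' : B) : (Q.twist v).mul b b' = Q.mulForm v b b'
    (((1 : H) ⊗ₜ[k] (Q.Phi⁻¹).val) * mapRight (mapRight Q.comul) Q.Phi.val) := rfl

/-- The two middle legs enclose α as S(X²₁) α X²₂ = ε(X²) α, and (id ⊗ ε ⊗ id)(Φ) = 1. -/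
theorem mulForm_Phi_mul (b b' : B) (W : H ⊗[k] (H ⊗[k] (H ⊗[k] H))) :
    Q.mulForm v b b' (mapRight (mapLeft Q.comul) Q.Phi.val * W) = Q.mulForm v b b' W := by
  let ι : H ⊗[k] H →ₐ[k] H ⊗[k] (H ⊗[k] (H ⊗[k] H)) := mapRight
    (Algebra.TensorProduct.includeRight.comp Algebra.TensorProduct.includeRight)
  have e (Z) : Q.mulForm v b b' (mapRight (mapLeft Q.comul) Z * W) =
      Q.mulForm v b b' (ι (mapRight (contractLeft Q.counit) Z) * W) := by
    induction Z using tensor3_induction with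
    | add a b ha hb => simp only [map_add, add_mul, ha, hb]
    | tmul x y z =>
      induction W using tensor4_induction with
      | add a b ha hb => simp only [map_add, mul_add, ha, hb]
      | tmul p q r s =>
        have e (d : H ⊗[k] H) : Q.mulForm v b b'
            (x ⊗ₜ TensorProduct.assoc k H H H (d ⊗ₜ z) * (p ⊗ₜ (q ⊗ₜ (r ⊗ₜ s)))) =
            v x * v p * b * v (Q.S q) *
              sandwich (v.toLinearMap ∘ₗ Q.S.toLinearMap) (v Q.alpha) v.toLinearMap d *
              (v r * b' * v (Q.S (z * s))) := by
          induction d using tensor2_induction with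
          | add a b ha hb =>
            simp only [map_add, TensorProduct.tmul_add, TensorProduct.add_tmul, mul_add, add_mul,
              ha, hb]
          | tmul p q => simp [mulForm_tmul, Q.S_mul, mul_assoc]
        rw [mapRight_tmul, mapLeft_tmul, e, Q.map_sandwich_alpha_comul]
        have hι (w : H) : ι (x ⊗ₜ w) = x ⊗ₜ (1 ⊗ₜ (1 ⊗ₜ w)) := by simp [ι, mapRight_tmul]
        rw [mapRight_tmul, contractLeft_tmul, hι, tmul_mul_tmul, tmul_mul_tmul, tmul_mul_tmul,
          mulForm_tmul]
        simp [mul_assoc]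
  rw [e, Q.contract_mid_Phi, algHom_map_one, one_mul]

/-- The map `x ⊗ y ⊗ z ↦ Ψ(x ▷ b) v(y) b' v(S(z))`. -/
def prodForm (b b' : B) : H ⊗[k] (H ⊗[k] H) →ₗ[k] B :=
  sandwich (Q.untwistAct v b) 1 (Q.adj v b')

theorem prodForm_tmul (b b' : B) (x y z : H) : Q.prodForm v b b' (x ⊗ₜ (y ⊗ₜ z)) =
    Q.untwistAct v b x * (v y * b' * v (Q.S z)) := by
  simp [prodForm, adj_tmul]

/-- `b ∘ b' = Ψ(x¹ ▷ b) v(x²) b' v(S(x³))`. -/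
theorem twist_mul (b b' : B) : (Q.twist v).mul b b' = Q.prodForm v b b' (Q.Phi⁻¹).val := by
  -- What survives is (Φ ⊗ 1)(Δ ⊗ id ⊗ id)(Φ⁻¹): its factor Φ builds Ψ, and the coproduct of x¹
  -- builds the action on b.
  rw [twist_mul_eq_mulForm, Q.pentagon_mid, mulForm_Phi_mul]
  have hadd (Z Z') : Q.untwistAt v (Z + Z') = Q.untwistAt v Z + Q.untwistAt v Z' := by
    ext c
    exact map_add (Q.antipodeForm v c) Z Z'
  have e (Z W) : Q.mulForm v b b' (mapRight (mapRight Algebra.TensorProduct.includeLeft) Z *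
      mapLeft Q.comul W) =
      sandwich (Q.untwistAt v Z ∘ₗ (Q.twist v).act.flip b) 1 (Q.adj v b') W := by
    induction W using tensor3_induction with
    | add a b ha hb => simp only [map_add, mul_add, ha, hb]
    | tmul p q r =>
      induction Z using tensor3_induction with
      | add a b ha hb =>
        simp only [map_add, add_mul, ha, hb, hadd, sandwich_tmul, LinearMap.comp_apply,
          LinearMap.add_apply]
      | tmul x y z =>
        have e (d : H ⊗[k] H) : Q.mulForm v b b' (x ⊗ₜ (y ⊗ₜ (z ⊗ₜ 1)) *
            TensorProduct.assoc k H H (H ⊗[k] H) (d ⊗ₜ (q ⊗ₜ r))) =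
            Q.antipodeForm v (Q.adj v b d) (x ⊗ₜ (y ⊗ₜ z)) * (v q * b' * v (Q.S r)) := by
          induction d using tensor2_induction with
          | add a b ha hb =>
            simp only [map_add, TensorProduct.add_tmul, mul_add, add_mul, ha, hb,
              antipodeForm_tmul]
          | tmul p q => simp [mulForm_tmul, antipodeForm_tmul, adj_tmul, Q.S_mul, mul_assoc]
        rw [mapRight_tmul, mapRight_tmul, mapLeft_tmul]
        refine (e _).trans ?_
        simp [adj_tmul, untwistAt_apply, twist_act]
  exact e _ _

/-- This is `untwist_act` applied to Ψ(g₁x ▷ b) g₂, which pulls g out to the left. -/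
theorem prodForm_comul_mul (b b' : B) (d : H ⊗[k] H) (Z : H ⊗[k] (H ⊗[k] H)) :
    Q.prodForm v b b' (mapLeft Q.comul d * Z) = Q.adj v (Q.prodForm v b b' Z) d := by
  have hadd (c c' : B) : Q.adj v (c + c') = Q.adj v c + Q.adj v c' := sandwich_add _ _ _ _
  induction Z using tensor3_induction with
  | add a b ha hb => simp only [map_add, mul_add, ha, hb, hadd, LinearMap.add_apply]
  | tmul x y z =>
    induction d using tensor2_induction with
    | add a b ha hb => simp only [map_add, add_mul, ha, hb]
    | tmul g h =>
      have e (d : H ⊗[k] H) : Q.prodForm v b b'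
          (TensorProduct.assoc k H H H (d ⊗ₜ h) * (x ⊗ₜ (y ⊗ₜ z))) =
          sandwich (Q.untwistAct v ((Q.twist v).act x b)) 1 v.toLinearMap d *
            (v y * b' * v (Q.S z) * v (Q.S h)) := by
        induction d using tensor2_induction with
        | add a b ha hb =>
          simp only [map_add, TensorProduct.add_tmul, add_mul, ha, hb]
        | tmul p q =>
          simp [prodForm_tmul, untwistAct_apply, twist_mul_act, Q.S_mul, mul_assoc]
      rw [mapLeft_tmul, e, untwist_act, adj_tmul, prodForm_tmul, untwistAct_apply]
      simp only [mul_assoc]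

theorem prodForm_mul_comul (b b' : B) (Z : H ⊗[k] (H ⊗[k] H)) (g h : H) :
    Q.prodForm v b b' (Z * mapRight Q.comul (g ⊗ₜ h)) =
      Q.prodForm v ((Q.twist v).act g b) ((Q.twist v).act h b') Z := by
  induction Z using tensor3_induction with
  | add a b ha hb => simp only [map_add, add_mul, ha, hb]
  | tmul x y z =>
    have e (d : H ⊗[k] H) : Q.prodForm v b b' ((x ⊗ₜ (y ⊗ₜ z)) * (g ⊗ₜ d)) =
        Q.untwistAct v b (x * g) * (v y * Q.adj v b' d * v (Q.S z)) := by
      induction d using tensor2_induction with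
      | add a b ha hb =>
        simp only [map_add, TensorProduct.tmul_add, mul_add, add_mul, ha, hb]
      | tmul p q => simp [prodForm_tmul, adj_tmul, Q.S_mul, mul_assoc]
    rw [mapRight_tmul, e, prodForm_tmul, untwistAct_apply, untwistAct_apply, twist_mul_act,
      twist_act Q v h]

/-- By `twist_mul`, the two sides are `prodForm` at (Δ ⊗ id)(Δ(h)) Φ⁻¹ and at Φ⁻¹ (id ⊗ Δ)(Δ(h)),
which agree by quasi-coassociativity. -/
theorem twist_act_mul (h : H) (b b' : B) : (Q.twist v).act h ((Q.twist v).mul b b') =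
    (Q.twist v).prod ((Q.twist v).act.flip b) ((Q.twist v).act.flip b') (Q.comul h) := by
  have e (d) : (Q.twist v).prod ((Q.twist v).act.flip b) ((Q.twist v).act.flip b') d =
      Q.prodForm v b b' ((Q.Phi⁻¹).val * mapRight Q.comul d) := by
    induction d using tensor2_induction with
    | add a b ha hb => simp only [map_add, mul_add, ha, hb]
    | tmul p q =>
      rw [prodForm_mul_comul, ModuleAlgebraData.prod_tmul, twist_mul]
      rfl
  rw [e, ← Q.comul_mul_Phi_inv, prodForm_comul_mul, ← twist_mul, twist_act]

/-- `Ψ(b ∘ b') = Ψ(X¹ ▷ b) Ψ(X² ▷ b') X³`. -/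
theorem untwist_mul (b b' : B) : Q.untwist v ((Q.twist v).mul b b') =
    sandwich (Q.untwistAct v b) 1 (sandwich (Q.untwistAct v b') 1 v.toLinearMap) Q.Phi.val := by
  let F : H ⊗[k] (H ⊗[k] (H ⊗[k] H)) →ₗ[k] B :=
    sandwich (Q.untwistAct v b) 1 (Q.antipodeForm v b')
  have hF (x t) : F (x ⊗ₜ t) = Q.untwistAct v b x * Q.antipodeForm v b' t := by simp [F]
  have hadd (c c' : B) : Q.antipodeForm v (c + c') = Q.antipodeForm v c + Q.antipodeForm v c' :=
    sandwich_add _ _ _ _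
  -- `untwist_act` carries X¹ to the right past Ψ(x¹ ▷ b), which produces (Δ ⊗ id ⊗ id)(Φ)(Φ⁻¹ ⊗ 1),
  -- the left side of `pentagon_left`.
  have e1 (Z W) : Q.antipodeForm v (Q.prodForm v b b' W) Z =
      F (mapLeft Q.comul Z * mapRight (mapRight Algebra.TensorProduct.includeLeft) W) := by
    induction W using tensor3_induction with
    | add a b ha hb => simp only [map_add, mul_add, ha, hb, hadd, LinearMap.add_apply]
    | tmul p q r =>
      induction Z using tensor3_induction with
      | add a b ha hb => simp only [map_add, add_mul, ha, hb]
      | tmul x y z =>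
        have e (d : H ⊗[k] H) : F (TensorProduct.assoc k H H (H ⊗[k] H) (d ⊗ₜ (y ⊗ₜ z)) *
            (p ⊗ₜ (q ⊗ₜ (r ⊗ₜ 1)))) =
            sandwich (Q.untwistAct v ((Q.twist v).act p b)) 1 v.toLinearMap d *
              (v q * b' * (v (Q.S r) * v (Q.S y) * v Q.alpha * v z)) := by
          induction d using tensor2_induction with
          | add a b ha hb => simp only [map_add, TensorProduct.add_tmul, add_mul, ha, hb]
          | tmul s t =>
            simp [hF, untwistAct_apply, antipodeForm_tmul, twist_mul_act, Q.S_mul, mul_assoc]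
        rw [mapRight_tmul, mapRight_tmul, mapLeft_tmul]
        refine Eq.trans ?_ (e _).symm
        rw [untwist_act, antipodeForm_tmul, prodForm_tmul, untwistAct_apply]
        simp only [mul_assoc]
  -- The outer factor (id ⊗ id ⊗ Δ)(Φ⁻¹) cancels across α, leaving (id ⊗ id ⊗ ε)(Φ⁻¹) = 1.
  have e2 (Z W) : F (mapRight (mapRight Q.comul) Z * W) =
      F (mapRight Algebra.TensorProduct.includeLeft
        (mapRight (contractRight Q.counit) Z) * W) := by
    induction Z using tensor3_induction with
    | add a b ha hb => simp only [map_add, add_mul, ha, hb]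
    | tmul x y z =>
      induction W using tensor4_induction with
      | add a b ha hb => simp only [map_add, mul_add, ha, hb]
      | tmul p q r s =>
        rw [mapRight_tmul, tmul_mul_tmul, hF]
        have e := Q.antipodeForm_comul_mul v b' (y ⊗ₜ z) (q ⊗ₜ (r ⊗ₜ s))
        rw [e, mapRight_tmul, mapRight_tmul, tmul_mul_tmul, hF,
          Algebra.TensorProduct.includeLeft_apply,
          tmul_mul_tmul, one_mul, antipodeForm_tmul, antipodeForm_tmul, map_mul v]
        simp only [mul_assoc]
  have e3 (W) : F (((1 : H) ⊗ₜ[k] Q.Phi.val) * mapRight (mapLeft Q.comul) W) =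
      sandwich (Q.untwistAct v b) 1 (sandwich (Q.untwistAct v b') 1 v.toLinearMap) W := by
    induction W using tensor2_induction with
    | add a b ha hb => simp only [map_add, mul_add, ha, hb]
    | tmul x t => rw [mapRight_tmul, tmul_mul_tmul, hF, antipodeForm_mul_comul]; simp
  rw [twist_mul, untwist_apply, e1, Q.pentagon_left, e2, Q.map_Phi_inv _ Q.contract_right_Phi,
    algHom_map_one, one_mul, e3]

/-- Both bracketings are values of Ψ(x ▷ b) Ψ(y ▷ b') z b'' S(w): the left one at (Φ ⊗ 1)(Δ ⊗ id ⊗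
id)(Φ⁻¹), the right one at (id ⊗ Δ ⊗ id)(Φ⁻¹)(1 ⊗ Φ⁻¹)(id ⊗ id ⊗ Δ)(Φ). The pentagon equates these
elements. -/
theorem twist_assoc (b b' b'' : B) : (Q.twist v).mul ((Q.twist v).mul b b') b'' =
    (Q.twist v).prod ((Q.twist v).act.flip b)
      ((Q.twist v).prod ((Q.twist v).act.flip b') ((Q.twist v).act.flip b'')) Q.Phi.val := by
  let F : H ⊗[k] (H ⊗[k] (H ⊗[k] H)) →ₗ[k] B :=
    sandwich (Q.untwistAct v b) 1 (Q.prodForm v b' b'')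
  have hF (x t) : F (x ⊗ₜ t) = Q.untwistAct v b x * Q.prodForm v b' b'' t := by simp [F]
  have e1 (W) : Q.prodForm v ((Q.twist v).mul b b') b'' W =
      F (mapRight (mapRight Algebra.TensorProduct.includeLeft) Q.Phi.val * mapLeft Q.comul W) := by
    induction W using tensor3_induction with
    | add a b ha hb => simp only [map_add, mul_add, ha, hb]
    | tmul x y z =>
      have e (d) : F (mapRight (mapRight Algebra.TensorProduct.includeLeft) Q.Phi.val *
            TensorProduct.assoc k H H (H ⊗[k] H) (d ⊗ₜ (y ⊗ₜ z))) =
          Q.untwist v ((Q.twist v).prod ((Q.twist v).act.flip b) ((Q.twist v).act.flip b') d) *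
            (v y * b'' * v (Q.S z)) := by
        induction d using tensor2_induction with
        | add a b ha hb => simp only [map_add, TensorProduct.add_tmul, mul_add, add_mul, ha, hb]
        | tmul p q =>
          rw [ModuleAlgebraData.prod_tmul, untwist_mul]
          generalize Q.Phi.val = Z
          induction Z using tensor3_induction with
          | add a b ha hb => simp only [map_add, add_mul, ha, hb]
          | tmul r s t =>
            rw [mapRight_tmul, mapRight_tmul]
            simp [hF, prodForm_tmul, untwistAct_apply, twist_mul_act, mul_assoc]
      rw [mapLeft_tmul, e, prodForm_tmul, untwistAct_apply, twist_act_mul]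
  have e2 (x) (U : H ⊗[k] (H ⊗[k] H)) (W) : F (mapRight (mapLeft Q.comul) W * (x ⊗ₜ U)) =
      Q.prodForm v ((Q.twist v).act x b) (Q.prodForm v b' b'' U) W := by
    induction W using tensor3_induction with
    | add a b ha hb => simp only [map_add, add_mul, ha, hb]
    | tmul p q r =>
      rw [mapRight_tmul, tmul_mul_tmul, hF, prodForm_comul_mul, prodForm_tmul, adj_tmul,
        untwistAct_apply, untwistAct_apply, twist_mul_act]
  have e3 (Z) : (Q.twist v).prod ((Q.twist v).act.flip b)
      ((Q.twist v).prod ((Q.twist v).act.flip b') ((Q.twist v).act.flip b'')) Z =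
      F (mapRight (mapLeft Q.comul) (Q.Phi⁻¹).val *
        (((1 : H) ⊗ₜ[k] (Q.Phi⁻¹).val) * mapRight (mapRight Q.comul) Z)) := by
    induction Z using tensor3_induction with
    | add a b ha hb => simp only [map_add, mul_add, ha, hb]
    | tmul x y z =>
      rw [mapRight_tmul, tmul_mul_tmul, one_mul, e2, prodForm_mul_comul, ← twist_mul, ← twist_mul,
        ModuleAlgebraData.prod_tmul, ModuleAlgebraData.prod_tmul]
      rfl
  rw [e3, ← Q.pentagon_right, ← e1, ← twist_mul]

/-- Since Ψ(x¹ ▷ β) = ε(x¹) Ψ(β) = ε(x¹), only (ε ⊗ id ⊗ id)(Φ⁻¹) = 1 is left. -/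
theorem twist_one_mul (b : B) : (Q.twist v).mul (v Q.beta) b = b := by
  have e (Z) : Q.prodForm v (v Q.beta) b Z = Q.adj v b (contractLeft Q.counit Z) := by
    induction Z using tensor3_induction with
    | add a b ha hb => simp only [map_add, ha, hb]
    | tmul x y z =>
      rw [prodForm_tmul, untwistAct_apply, twist_act_one, map_smul, untwist_beta,
        contractLeft_tmul, map_smul, adj_tmul, smul_mul_assoc, one_mul]
  rw [twist_mul, e, Q.map_Phi_inv _ Q.contract_left_Phi]
  exact (congrArg _ Q.comul.map_one.symm).trans (Q.twist_one_act v b)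

/-- Here the defining formula is the convenient one: X³₁ β S(X³₂) = ε(X³) β, after which S(x¹) α x²
β S(x³) = 1 applies. -/
theorem twist_mul_one (b : B) : (Q.twist v).mul b (v Q.beta) = b := by
  have e (U Z) : Q.mulForm v b (v Q.beta)
      (((1 : H) ⊗ₜ[k] U) * mapRight (mapRight Q.comul) Z) =
      sandwich v.toLinearMap b (LinearMap.mulRight k (v (sandwich Q.S.toLinearMap Q.alpha
        (sandwich LinearMap.id Q.beta Q.S.toLinearMap) U)) ∘ₗ v.toLinearMap ∘ₗ Q.S.toLinearMap)
        (mapRight (contractRight Q.counit) Z) := by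
    induction Z using tensor3_induction with
    | add a b ha hb => simp only [map_add, mul_add, ha, hb]
    | tmul x y z =>
      rw [mapRight_tmul, mapRight_tmul, mapRight_tmul, contractRight_tmul, sandwich_tmul]
      induction U using tensor3_induction with
      | add a b ha hb =>
        simp only [map_add, TensorProduct.tmul_add, mul_add, add_mul, ha, hb,
          LinearMap.comp_apply, LinearMap.mulRight_apply]
      | tmul p q r =>
        have e (d : H ⊗[k] H) : Q.mulForm v b (v Q.beta)
            ((1 ⊗ₜ (p ⊗ₜ (q ⊗ₜ r))) * (x ⊗ₜ (y ⊗ₜ d))) =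
            v x * b * (v (Q.S y) * (v (Q.S p) * v Q.alpha * v q *
              sandwich v.toLinearMap (v Q.beta) (v.toLinearMap ∘ₗ Q.S.toLinearMap) d *
                v (Q.S r))) := by
          induction d using tensor2_induction with
          | add a b ha hb =>
            simp only [map_add, TensorProduct.tmul_add, mul_add, add_mul, ha, hb]
          | tmul s t => simp [mulForm_tmul, Q.S_mul, mul_assoc]
        rw [e, map_sandwich_beta_comul]
        simp [mul_assoc]
  rw [twist_mul_eq_mulForm, e, Q.antipode_Phi_inv, Q.contract_right_Phi]
  refine (sandwich_tmul _ _ _ (1 : H) (1 : H)).trans ?_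
  simp [Q.S_one]

theorem twist_isModuleAlgebra : (Q.twist v).IsModuleAlgebra Q.toQuasiBialgebra where
  one_act := Q.twist_one_act v
  mul_act := Q.twist_mul_act v
  one_mul := Q.twist_one_mul v
  mul_one := Q.twist_mul_one v
  quasi_assoc := Q.twist_assoc v
  act_mul := Q.twist_act_mul v
  act_one := Q.twist_act_one v

end QuasiHopfAlgebra

/-- Operations that embed into a module algebra form a module algebra. -/
theorem ModuleAlgebraData.IsModuleAlgebra.of_injective {k H A A' : Type*} [Field k] [Ring H]
    [Algebra k H] [AddCommGroup A] [Module k A] [AddCommGroup A'] [Module k A']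
    {Q : QuasiBialgebra k H} {D : ModuleAlgebraData k H A} {D' : ModuleAlgebraData k H A'}
    (h' : D'.IsModuleAlgebra Q) {f : A →ₗ[k] A'} (hf : D.IsHom D' f)
    (inj : Function.Injective f) : D.IsModuleAlgebra Q := by
  have hact (a : A) : f ∘ₗ D.act.flip a = D'.act.flip (f a) := by
    ext h
    exact hf.map_act h a
  have hprod {M N : Type _} [AddCommGroup M] [Module k M] [AddCommGroup N] [Module k N]
      (p : M →ₗ[k] A) (q : N →ₗ[k] A) (t : M ⊗[k] N) :
      f (D.prod p q t) = D'.prod (f ∘ₗ p) (f ∘ₗ q) t := by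
    induction t using tensor2_induction with
    | tmul x y => simp [prod_tmul, hf.map_mul]
    | add a b ha hb => simp only [map_add, ha, hb]
  have hprod' {M N : Type _} [AddCommGroup M] [Module k M] [AddCommGroup N] [Module k N]
      (p : M →ₗ[k] A) (q : N →ₗ[k] A) : f ∘ₗ D.prod p q = D'.prod (f ∘ₗ p) (f ∘ₗ q) :=
    LinearMap.ext (hprod p q)
  exact
    { one_act := fun a => inj (by rw [hf.map_act, h'.one_act])
      mul_act := fun g h a => inj (by simp only [hf.map_act, h'.mul_act])
      one_mul := fun a => inj (by rw [hf.map_mul, hf.map_one, h'.one_mul])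
      mul_one := fun a => inj (by rw [hf.map_mul, hf.map_one, h'.mul_one])
      quasi_assoc := fun a a' a'' => inj (by
        rw [hf.map_mul, hf.map_mul, h'.quasi_assoc, hprod, hprod', hact, hact, hact])
      act_mul := fun h a a' => inj (by
        rw [hf.map_act, hf.map_mul, h'.act_mul, hprod, hact, hact])
      act_one := fun h => inj (by rw [hf.map_act, hf.map_one, h'.act_one, map_smul, hf.map_one]) }

/-! ### The projection E and its reconstruction from the coaction. -/

namespace QuasiHopfAlgebra

variable {k H B : Type*} [Field k] [Ring H] [Algebra k H] [Ring B] [Algebra k B]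
  (Q : QuasiHopfAlgebra k H) (R : RightComoduleAlgebra Q.toQuasiBialgebra B) (v : H →ₐ[k] B)

/-- `v ⊗ id`. -/
abbrev mapFirst (N : Type*) [Ring N] [Algebra k N] : H ⊗[k] N →ₐ[k] B ⊗[k] N :=
  Algebra.TensorProduct.map v (AlgHom.id k N)

theorem mapFirst_tmul {N : Type*} [Ring N] [Algebra k N] (h : H) (n : N) :
    mapFirst v N (h ⊗ₜ n) = v h ⊗ₜ n := by
  simp

/-- The map `b ⊗ h ↦ b v(β S(h))`. -/
def betaForm : B ⊗[k] H →ₗ[k] B :=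
  sandwich LinearMap.id (v Q.beta) (v.toLinearMap ∘ₗ Q.S.toLinearMap)

theorem betaForm_tmul (b : B) (h : H) :
    Q.betaForm v (b ⊗ₜ h) = b * v Q.beta * v (Q.S h) := by
  simp [betaForm]

/-- The map `b ↦ b₍₀₎ v(β S(b₍₁₎))`. -/
def cotwist : B →ₗ[k] B := Q.betaForm v ∘ₗ R.rho.toLinearMap

theorem cotwist_apply (b : B) : Q.cotwist R v b = Q.betaForm v (R.rho b) := rfl

/-- `S` undoes the S⁻¹ in q_R: S(S⁻¹(α X³) X² b₍₁₎) = S(b₍₁₎) S(X²) α X³. -/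
theorem E_eq_untwist (b : B) : Q.E R v b = Q.untwist v (Q.cotwist R v b) := by
  have hadd (c c' : B) : Q.antipodeForm v (c + c') = Q.antipodeForm v c + Q.antipodeForm v c' :=
    sandwich_add _ _ _ _
  have e (Z : H ⊗[k] (H ⊗[k] H)) (W) : Q.betaForm v (mapFirst v H (TensorProduct.map LinearMap.id
      (sandwich (Q.S.symm.toLinearMap ∘ₗ LinearMap.mulLeft k Q.alpha) 1 LinearMap.id ∘ₗ
      (TensorProduct.comm k H H).toLinearMap) Z) * W) =
      Q.antipodeForm v (Q.betaForm v W) Z := by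
    induction Z using tensor3_induction with
    | add a b ha hb => simp only [map_add, add_mul, ha, hb]
    | tmul x y z =>
      induction W using tensor2_induction with
      | add a b ha hb => simp only [map_add, mul_add, ha, hb, hadd, LinearMap.add_apply]
      | tmul c g => simp [betaForm_tmul, antipodeForm_tmul, Q.S_mul, mul_assoc]
  exact e _ _

variable {R v}

theorem rho_map (hv : IsComoduleAlgebraHom (RightComoduleAlgebra.regular Q.toQuasiBialgebra) R v)
    (h : H) : R.rho (v h) = mapFirst v H (Q.comul h) := hv.rho_comp h

theorem PhiRho_eq
    (hv : IsComoduleAlgebraHom (RightComoduleAlgebra.regular Q.toQuasiBialgebra) R v) :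
    R.PhiRho.val = mapFirst v (H ⊗[k] H) Q.Phi.val := hv.map_PhiRho

theorem contractRight_rho (b : B) : contractRight Q.counit (R.rho b) = b := by
  simp [contractRight, R.counit_rho]

/-- Because ρ(v(h)) = v(h₁) ⊗ h₂, the extra factor appears as h₁ β S(h₂). -/
theorem cotwist_mul_map
    (hv : IsComoduleAlgebraHom (RightComoduleAlgebra.regular Q.toQuasiBialgebra) R v)
    (b : B) (h : H) : Q.cotwist R v (b * v h) = Q.counit h • Q.cotwist R v b := by
  rw [cotwist_apply, map_mul, Q.rho_map hv, cotwist_apply]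
  induction R.rho b using tensor2_induction with
  | add a b ha hb => simp only [map_add, add_mul, smul_add, ha, hb]
  | tmul c g =>
    have e (d : H ⊗[k] H) : Q.betaForm v ((c ⊗ₜ g) * mapFirst v H d) = c *
        sandwich v.toLinearMap (v Q.beta) (v.toLinearMap ∘ₗ Q.S.toLinearMap) d * v (Q.S g) := by
      induction d using tensor2_induction with
      | add a b ha hb => simp only [map_add, mul_add, add_mul, ha, hb]
      | tmul p q => simp [betaForm_tmul, Q.S_mul, mul_assoc]
    rw [e, map_sandwich_beta_comul, betaForm_tmul, mul_smul_comm, smul_mul_assoc]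

theorem cotwist_map_mul
    (hv : IsComoduleAlgebraHom (RightComoduleAlgebra.regular Q.toQuasiBialgebra) R v)
    (h : H) (b : B) : Q.cotwist R v (v h * b) = (Q.twist v).act h (Q.cotwist R v b) := by
  have hadd (c c' : B) : Q.adj v (c + c') = Q.adj v c + Q.adj v c' := sandwich_add _ _ _ _
  rw [cotwist_apply, map_mul, Q.rho_map hv, cotwist_apply, twist_act]
  generalize Q.comul h = d
  induction R.rho b using tensor2_induction with
  | add a b ha hb => simp only [map_add, mul_add, ha, hb, hadd, LinearMap.add_apply]
  | tmul c g =>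
    induction d using tensor2_induction with
    | add a b ha hb => simp only [map_add, add_mul, ha, hb]
    | tmul p q => simp [betaForm_tmul, adj_tmul, Q.S_mul, mul_assoc]

theorem E_mul_map
    (hv : IsComoduleAlgebraHom (RightComoduleAlgebra.regular Q.toQuasiBialgebra) R v)
    (b : B) (h : H) : Q.E R v (b * v h) = Q.counit h • Q.E R v b := by
  rw [E_eq_untwist, cotwist_mul_map Q hv, map_smul, ← E_eq_untwist]

/-- The map `b ⊗ x ⊗ y ↦ P(b) u(β S(x) α y)`. -/
def coantipodeForm {C : Type*} [Ring C] [Algebra k C] (P : B →ₗ[k] C) (u : H →ₐ[k] C) :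
    B ⊗[k] (H ⊗[k] H) →ₗ[k] C :=
  sandwich P (u Q.beta)
    (sandwich (u.toLinearMap ∘ₗ Q.S.toLinearMap) (u Q.alpha) u.toLinearMap)

theorem coantipodeForm_tmul {C : Type*} [Ring C] [Algebra k C] (P : B →ₗ[k] C) (u : H →ₐ[k] C)
    (b : B) (x y : H) : Q.coantipodeForm P u (b ⊗ₜ (x ⊗ₜ y)) =
      P b * u Q.beta * (u (Q.S x) * u Q.alpha * u y) := by
  simp [coantipodeForm]

/-- `E(b₍₀₎) b₍₁₎ = b`. -/
theorem E_rho (hv : IsComoduleAlgebraHom (RightComoduleAlgebra.regular Q.toQuasiBialgebra) R v)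
    (b : B) : sandwich (Q.E R v) 1 v.toLinearMap (R.rho b) = b := by
  have e1 (W) : sandwich (Q.E R v) 1 v.toLinearMap W =
      Q.coantipodeForm LinearMap.id v (mapFirst v _ Q.Phi.val * mapLeft R.rho W) := by
    induction W using tensor2_induction with
    | add a b ha hb => simp only [map_add, mul_add, ha, hb]
    | tmul c h =>
      have hadd (c c' : B) :
          Q.antipodeForm v (c + c') = Q.antipodeForm v c + Q.antipodeForm v c' :=
        sandwich_add _ _ _ _
      have e (Z) (w) : Q.coantipodeForm LinearMap.id v (mapFirst v _ Z *
          TensorProduct.assoc k B H H (w ⊗ₜ h)) =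
            Q.antipodeForm v (Q.betaForm v w) Z * v h := by
        induction w using tensor2_induction with
        | add a b ha hb =>
          simp only [map_add, TensorProduct.add_tmul, mul_add, add_mul, ha, hb, hadd,
            LinearMap.add_apply]
        | tmul p q =>
          induction Z using tensor3_induction with
          | add a b ha hb => simp only [map_add, add_mul, ha, hb]
          | tmul x y z =>
            simp [coantipodeForm_tmul, antipodeForm_tmul, betaForm_tmul, Q.S_mul, mul_assoc]
      rw [mapLeft_tmul, e, sandwich_tmul, E_eq_untwist, mul_one]
      rfl
  have e2 (W) (Z) : Q.coantipodeForm LinearMap.id v (mapRight Q.comul W * Z) =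
      contractRight Q.counit W * Q.coantipodeForm LinearMap.id v Z := by
    induction W using tensor2_induction with
    | add a b ha hb => simp only [map_add, add_mul, ha, hb]
    | tmul c h =>
      induction Z using tensor3_induction with
      | add a b ha hb => simp only [map_add, mul_add, ha, hb]
      | tmul x y z =>
        have e (d : H ⊗[k] H) : Q.coantipodeForm LinearMap.id v (c ⊗ₜ d * (x ⊗ₜ (y ⊗ₜ z))) =
            c * x * v Q.beta * v (Q.S y) *
              sandwich (v.toLinearMap ∘ₗ Q.S.toLinearMap) (v Q.alpha) v.toLinearMap d * v z := by
          induction d using tensor2_induction with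
          | add a b ha hb => simp only [map_add, TensorProduct.tmul_add, mul_add, add_mul, ha, hb]
          | tmul p q => simp [coantipodeForm_tmul, Q.S_mul, mul_assoc]
        rw [mapRight_tmul, e, Q.map_sandwich_alpha_comul, contractRight_tmul, coantipodeForm_tmul]
        simp [mul_assoc]
  have e3 (Z) : Q.coantipodeForm LinearMap.id v (mapFirst v _ Z) =
      Q.antipodeForm v (v Q.beta) Z := by
    induction Z using tensor3_induction with
    | add a b ha hb => simp only [map_add, ha, hb]
    | tmul x y z => simp [coantipodeForm_tmul, antipodeForm_tmul]
  -- The comodule law turns Φ_ρ (ρ ⊗ id)(ρ(b)) into (id ⊗ Δ)(ρ(b)) Φ_ρ; the coproduct cancels across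
  -- α to leave b, and the rest is Ψ(β) = 1.
  rw [e1, ← Q.PhiRho_eq hv, R.quasi_coassoc, e2, contractRight_rho, Q.PhiRho_eq hv, e3,
    ← untwist_apply, untwist_beta, mul_one]

theorem mapLeft_rho
    (hv : IsComoduleAlgebraHom (RightComoduleAlgebra.regular Q.toQuasiBialgebra) R v) (b : B) :
    mapLeft R.rho (R.rho b) =
      mapFirst v _ (Q.Phi⁻¹).val * (mapRight Q.comul (R.rho b) * mapFirst v _ Q.Phi.val) := by
  have h := Q.map_Phi_inv_mul (mapFirst v (H ⊗[k] H))
  rw [← Q.PhiRho_eq hv, ← R.quasi_coassoc, ← mul_assoc, Q.PhiRho_eq hv, h, one_mul]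

theorem mapFirst_mul_mapRight
    (hv : IsComoduleAlgebraHom (RightComoduleAlgebra.regular Q.toQuasiBialgebra) R v) (b : B) :
    mapFirst v _ (Q.Phi⁻¹).val * mapRight Q.comul (R.rho b) =
      mapLeft R.rho (R.rho b) * mapFirst v _ (Q.Phi⁻¹).val := by
  have h := Q.map_Phi_mul_inv (mapFirst v (H ⊗[k] H))
  rw [Q.mapLeft_rho hv, mul_assoc, mul_assoc, h, mul_one]

/-- A linear map `D` with `D(b h) = ε(h) D(b)` is recovered from `P(b) = D(b₍₀₎) u(b₍₁₎)` as
`D(b) = P(X¹ b₍₀₎) u(β S(X² b₍₁₎) α X³)`. -/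
theorem coantipodeForm_rho
    (hv : IsComoduleAlgebraHom (RightComoduleAlgebra.regular Q.toQuasiBialgebra) R v)
    {C : Type*} [Ring C] [Algebra k C] (u : H →ₐ[k] C) (D P : B →ₗ[k] C)
    (hD : ∀ b h, D (b * v h) = Q.counit h • D b)
    (hP : ∀ b, P b = sandwich D 1 u.toLinearMap (R.rho b)) (b : B) :
    Q.coantipodeForm P u (mapFirst v _ Q.Phi.val *
      mapRight Algebra.TensorProduct.includeLeft (R.rho b)) = D b := by
  let N : B ⊗[k] (H ⊗[k] (H ⊗[k] H)) →ₗ[k] C := sandwich D 1 (Q.antipodeForm u (u Q.beta))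
  have hN (c t) : N (c ⊗ₜ t) = D c * Q.antipodeForm u (u Q.beta) t := by simp [N]
  let inc : B ⊗[k] (H ⊗[k] H) →ₐ[k] B ⊗[k] (H ⊗[k] (H ⊗[k] H)) :=
    mapRight (mapRight Algebra.TensorProduct.includeLeft)
  have hinc (c x y) : inc (c ⊗ₜ (x ⊗ₜ y)) = c ⊗ₜ (x ⊗ₜ (y ⊗ₜ 1)) := by
    simp [inc, mapRight_tmul]
  let incl : B →ₐ[k] B ⊗[k] (H ⊗[k] (H ⊗[k] H)) := Algebra.TensorProduct.includeLeft
  have hincl (c) : incl c = c ⊗ₜ 1 := rfl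
  -- Substituting the formula for P into P(X¹ b₍₀₎) splits X¹ and b₍₀₎ once more.
  have e1 (Z W) : Q.coantipodeForm P u (mapFirst v _ Z *
      mapRight Algebra.TensorProduct.includeLeft W) =
      N (mapFirst v _ (mapLeft Q.comul Z) * inc (mapLeft R.rho W)) := by
    induction Z using tensor3_induction with
    | add a b ha hb => simp only [map_add, add_mul, ha, hb]
    | tmul x y z =>
      induction W using tensor2_induction with
      | add a b ha hb => simp only [map_add, mul_add, ha, hb]
      | tmul c g =>
        have e (d : H ⊗[k] H) (w : B ⊗[k] H) :
            N (mapFirst v _ (TensorProduct.assoc k H H (H ⊗[k] H) (d ⊗ₜ (y ⊗ₜ z))) *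
              inc (TensorProduct.assoc k B H H (w ⊗ₜ g))) =
            sandwich D 1 u.toLinearMap (mapFirst v H d * w) * u Q.beta *
              (u (Q.S (y * g)) * u Q.alpha * u z) := by
          induction d using tensor2_induction with
          | add a b ha hb => simp only [map_add, TensorProduct.add_tmul, add_mul, ha, hb]
          | tmul p q =>
            induction w using tensor2_induction with
            | add a b ha hb => simp only [map_add, TensorProduct.add_tmul, mul_add, add_mul, ha, hb]
            | tmul r s => simp [hinc, hN, antipodeForm_tmul, Q.S_mul, mul_assoc]
        rw [mapLeft_tmul, mapLeft_tmul, e, ← Q.rho_map hv, ← map_mul R.rho, ← hP]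
        simp [mapRight_tmul, coantipodeForm_tmul]
  have e2 (Z : H ⊗[k] (H ⊗[k] H)) : inc (mapFirst v _ Z) =
      mapFirst v _ (mapRight (mapRight Algebra.TensorProduct.includeLeft) Z) := by
    induction Z using tensor3_induction with
    | add a b ha hb => simp only [map_add, ha, hb]
    | tmul x y z => simp [hinc, mapRight_tmul]
  -- The trailing Φ of `mapLeft_rho` disappears because D sees its first leg only through ε.
  have e3 (W : B ⊗[k] (H ⊗[k] (H ⊗[k] H))) (Z : H ⊗[k] (H ⊗[k] H)) : N (W * inc (mapFirst v _ Z)) =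
      N (W * inc (Algebra.TensorProduct.includeRight (contractLeft Q.counit Z))) := by
    induction W using tensor4_induction with
    | add a b ha hb => simp only [map_add, add_mul, ha, hb]
    | tmul c p q r =>
      induction Z using tensor3_induction with
      | add a b ha hb => simp only [map_add, mul_add, ha, hb]
      | tmul x y z =>
        rw [contractLeft_tmul, map_smul, map_smul, mul_smul_comm, map_smul,
          Algebra.TensorProduct.includeRight_apply, mapFirst_tmul, hinc, hinc]
        simp only [tmul_mul_tmul, hN, hD, mul_one, smul_mul_assoc]
  -- The two legs of the coproduct of b₍₁₎ enclose β, so only b itself remains.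
  have e4 (W : B ⊗[k] (H ⊗[k] (H ⊗[k] H))) (V : B ⊗[k] H) : N (W * inc (mapRight Q.comul V)) =
      N (W * incl (contractRight Q.counit V)) := by
    induction W using tensor4_induction with
    | add a b ha hb => simp only [map_add, add_mul, ha, hb]
    | tmul c p q r =>
      induction V using tensor2_induction with
      | add a b ha hb => simp only [map_add, mul_add, ha, hb]
      | tmul a g =>
        have e (d : H ⊗[k] H) : N ((c ⊗ₜ (p ⊗ₜ (q ⊗ₜ r))) * inc (a ⊗ₜ d)) =
            D (c * a) * (u p * sandwich u.toLinearMap (u Q.beta)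
              (u.toLinearMap ∘ₗ Q.S.toLinearMap) d * (u (Q.S q) * u Q.alpha * u r)) := by
          induction d using tensor2_induction with
          | add a b ha hb => simp only [map_add, TensorProduct.tmul_add, mul_add, add_mul, ha, hb]
          | tmul s t =>
            rw [hinc]
            simp [hN, antipodeForm_tmul, Q.S_mul, mul_assoc]
        rw [mapRight_tmul, e, map_sandwich_beta_comul, contractRight_tmul, hincl,
          tmul_mul_tmul, mul_one, hN, antipodeForm_tmul]
        simp [mul_assoc]
  have e5 (Z : H ⊗[k] (H ⊗[k] H)) (W) : N (mapFirst v _ (mapRight (mapRight Q.comul) Z) * W) =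
      N (mapFirst v _ (mapRight Algebra.TensorProduct.includeLeft
        (mapRight (contractRight Q.counit) Z)) * W) := by
    induction Z using tensor3_induction with
    | add a b ha hb => simp only [map_add, add_mul, ha, hb]
    | tmul x y z =>
      induction W using tensor4_induction with
      | add a b ha hb => simp only [map_add, mul_add, ha, hb]
      | tmul p q r s =>
        have e := Q.antipodeForm_comul_mul u (u Q.beta) (y ⊗ₜ z) (q ⊗ₜ (r ⊗ₜ s))
        rw [mapRight_tmul, mapFirst_tmul, tmul_mul_tmul, hN, e, mapRight_tmul, mapRight_tmul,
          mapFirst_tmul, tmul_mul_tmul, hN, Algebra.TensorProduct.includeLeft_apply,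
          tmul_mul_tmul, one_mul, antipodeForm_tmul, antipodeForm_tmul, map_mul u]
        simp only [mul_assoc]
  have e6 (Z) (U) : N (mapFirst v _ (((1 : H) ⊗ₜ[k] U) * mapRight (mapLeft Q.comul) Z) *
      incl b) =
      sandwich (D ∘ₗ LinearMap.mulRight k b ∘ₗ v.toLinearMap) 1
        (LinearMap.mulLeft k (Q.antipodeForm u (u Q.beta) U) ∘ₗ u.toLinearMap)
        (mapRight (contractLeft Q.counit) Z) := by
    induction Z using tensor3_induction with
    | add a b ha hb => simp only [map_add, mul_add, add_mul, ha, hb]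
    | tmul x y z =>
      rw [mapRight_tmul, mapRight_tmul, contractLeft_tmul, sandwich_tmul, mapLeft_tmul,
        tmul_mul_tmul, mapFirst_tmul, hincl, tmul_mul_tmul, mul_one, hN,
        one_mul]
      have e (d : H ⊗[k] H) : Q.antipodeForm u (u Q.beta)
          (U * TensorProduct.assoc k H H H (d ⊗ₜ z)) = Q.antipodeForm u
            (sandwich u.toLinearMap (u Q.beta) (u.toLinearMap ∘ₗ Q.S.toLinearMap) d) U * u z := by
        have hadd (c c' : C) :
            Q.antipodeForm u (c + c') = Q.antipodeForm u c + Q.antipodeForm u c' :=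
          sandwich_add _ _ _ _
        induction d using tensor2_induction with
        | add a b ha hb =>
          simp only [map_add, TensorProduct.add_tmul, mul_add, add_mul, ha, hb, hadd,
            LinearMap.add_apply]
        | tmul s t =>
          induction U using tensor3_induction with
          | add a b ha hb => simp only [map_add, add_mul, ha, hb]
          | tmul p q r => simp [antipodeForm_tmul, Q.S_mul, mul_assoc]
      rw [e, map_sandwich_beta_comul, ← untwistAt_apply, map_smul, untwistAt_apply]
      simp
  -- In (id ⊗ id ⊗ Δ)(Φ⁻¹)(1 ⊗ Φ)(id ⊗ Δ ⊗ id)(Φ), the left factor cancels across α (`e5`), the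
  -- right one across β (`e6`), and the middle one gives X¹ β S(X²) α X³ = 1.
  have h1 := congrArg (mapFirst v (H ⊗[k] (H ⊗[k] H))) Q.pentagon_left
  rw [map_mul, map_mul] at h1
  rw [e1, Q.mapLeft_rho hv, map_mul inc, map_mul inc, ← mul_assoc, ← mul_assoc, e3,
    Q.contract_left_Phi, algHom_map_one, algHom_map_one, mul_one, e4, contractRight_rho, e2, h1,
    mul_assoc, e5, Q.map_Phi_inv _ Q.contract_right_Phi, algHom_map_one, algHom_map_one, one_mul,
    e6, Q.contract_mid_Phi]
  refine (sandwich_tmul _ _ _ (1 : H) (1 : H)).trans ?_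
  rw [← untwist_apply, untwist_beta]
  simp

end QuasiHopfAlgebra

/-! ### The coaction on coinvariants and the map θ. -/

namespace QuasiHopfAlgebra

variable {k H B : Type*} [Field k] [Ring H] [Algebra k H] [Ring B] [Algebra k B]
  (Q : QuasiHopfAlgebra k H) (R : RightComoduleAlgebra Q.toQuasiBialgebra B) (v : H →ₐ[k] B)

/-- The map `b ⊗ x ⊗ y ↦ E(b) v(x) ⊗ y`. -/
def coinvForm : B ⊗[k] (H ⊗[k] H) →ₗ[k] B ⊗[k] H :=
  TensorProduct.map (sandwich (Q.E R v) 1 v.toLinearMap) LinearMap.id ∘ₗ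
    (TensorProduct.assoc k B H H).symm.toLinearMap

theorem coinvForm_tmul (b : B) (x y : H) :
    Q.coinvForm R v (b ⊗ₜ (x ⊗ₜ y)) = (Q.E R v b * v x) ⊗ₜ y := by
  simp [coinvForm]

/-- The map `b ↦ E(x¹ b) v(x²) ⊗ x³`. -/
def coinvRho : B →ₗ[k] B ⊗[k] H :=
  Q.coinvForm R v ∘ₗ LinearMap.mulLeft k (mapFirst v (H ⊗[k] H) (Q.Phi⁻¹).val) ∘ₗ
    (Algebra.TensorProduct.includeLeft : B →ₐ[k] B ⊗[k] (H ⊗[k] H)).toLinearMap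

theorem coinvRho_apply (b : B) : Q.coinvRho R v b = Q.coinvForm R v
    (mapFirst v (H ⊗[k] H) (Q.Phi⁻¹).val * (b ⊗ₜ 1)) := rfl

variable {R v}

theorem coinvRho_mul_map
    (hv : IsComoduleAlgebraHom (RightComoduleAlgebra.regular Q.toQuasiBialgebra) R v)
    (b : B) (h : H) : Q.coinvRho R v (b * v h) = Q.counit h • Q.coinvRho R v b := by
  rw [coinvRho_apply, coinvRho_apply]
  generalize (Q.Phi⁻¹).val = Z
  induction Z using tensor3_induction with
  | add a b ha hb => simp only [map_add, add_mul, smul_add, ha, hb]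
  | tmul x y z =>
    rw [mapFirst_tmul, tmul_mul_tmul, tmul_mul_tmul, mul_one, coinvForm_tmul, coinvForm_tmul,
      ← mul_assoc, Q.E_mul_map hv, smul_mul_assoc, TensorProduct.smul_tmul']

/-- This is the hypothesis `hP` of `coantipodeForm_rho` for D = `coinvRho`. Moving Φ⁻¹ past the
iterated coaction reduces the right side to E(b₍₀₎₍₀₎) b₍₀₎₍₁₎ ⊗ b₍₁₎, which `E_rho` evaluates. -/
theorem rho_eq_coinvRho
    (hv : IsComoduleAlgebraHom (RightComoduleAlgebra.regular Q.toQuasiBialgebra) R v) (b : B) :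
    R.rho b = sandwich (Q.coinvRho R v) 1 (R.rho.comp v).toLinearMap (R.rho b) := by
  have e1 (W) : sandwich (Q.coinvRho R v) 1 (R.rho.comp v).toLinearMap W =
      Q.coinvForm R v (mapFirst v (H ⊗[k] H) (Q.Phi⁻¹).val * mapRight Q.comul W) := by
    induction W using tensor2_induction with
    | add a b ha hb => simp only [map_add, mul_add, ha, hb]
    | tmul c h =>
      rw [sandwich_tmul, mul_one, AlgHom.toLinearMap_apply, AlgHom.comp_apply, Q.rho_map hv,
        coinvRho_apply, mapRight_tmul]
      generalize (Q.Phi⁻¹).val = Z, Q.comul h = d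
      induction Z using tensor3_induction with
      | add a b ha hb => simp only [map_add, add_mul, ha, hb]
      | tmul x y z =>
        induction d using tensor2_induction with
        | add a b ha hb => simp only [map_add, TensorProduct.tmul_add, mul_add, ha, hb]
        | tmul s t =>
          rw [mapFirst_tmul, tmul_mul_tmul, tmul_mul_tmul, mul_one, coinvForm_tmul, tmul_mul_tmul,
            coinvForm_tmul, mapFirst_tmul, tmul_mul_tmul, map_mul v, mul_assoc]
  have e2 (W) (Z : H ⊗[k] (H ⊗[k] H)) :
      Q.coinvForm R v (mapLeft R.rho W * mapFirst v (H ⊗[k] H) Z) =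
      W * mapFirst v H (contractLeft Q.counit Z) := by
    induction W using tensor2_induction with
    | add a b ha hb => simp only [map_add, add_mul, ha, hb]
    | tmul c g =>
      induction Z using tensor3_induction with
      | add a b ha hb => simp only [map_add, mul_add, ha, hb]
      | tmul x y z =>
        have e (w) : Q.coinvForm R v
            (TensorProduct.assoc k B H H (w ⊗ₜ g) * (v x ⊗ₜ (y ⊗ₜ z))) =
            Q.counit x • ((sandwich (Q.E R v) 1 v.toLinearMap w * v y) ⊗ₜ (g * z)) := by
          induction w using tensor2_induction with
          | add a b ha hb =>
            simp only [map_add, TensorProduct.add_tmul, add_mul, smul_add, ha, hb]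
          | tmul p q =>
            rw [TensorProduct.assoc_tmul, tmul_mul_tmul, tmul_mul_tmul, coinvForm_tmul,
              Q.E_mul_map hv, sandwich_tmul, mul_one, map_mul v, smul_mul_assoc,
              TensorProduct.smul_tmul', AlgHom.toLinearMap_apply, mul_assoc]
        rw [mapLeft_tmul, mapFirst_tmul, e, Q.E_rho hv, contractLeft_tmul, map_smul,
          mapFirst_tmul, mul_smul_comm, tmul_mul_tmul]
  rw [e1, Q.mapFirst_mul_mapRight hv, e2, Q.map_Phi_inv _ Q.contract_left_Phi, algHom_map_one,
    mul_one]

/-- `ρ(E(b)) = E(x¹ b) v(x²) ⊗ x³`. -/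
theorem rho_E (hv : IsComoduleAlgebraHom (RightComoduleAlgebra.regular Q.toQuasiBialgebra) R v)
    (b : B) : R.rho (Q.E R v b) = Q.coinvRho R v b := by
  have hid (b : B) : b = sandwich (Q.E R v) 1 v.toLinearMap (R.rho b) := (Q.E_rho hv b).symm
  -- Both E and `coinvRho` are given by the same reconstruction formula, with P the identity and P =
  -- ρ respectively; the algebra map ρ carries the first formula to the second.
  have h1 := Q.coantipodeForm_rho hv v (Q.E R v) LinearMap.id (Q.E_mul_map hv) hid b
  have h2 := Q.coantipodeForm_rho hv (R.rho.comp v) (Q.coinvRho R v) R.rho.toLinearMap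
    (Q.coinvRho_mul_map hv) (Q.rho_eq_coinvRho hv) b
  have e (W) : Q.coantipodeForm R.rho.toLinearMap (R.rho.comp v) W =
      R.rho (Q.coantipodeForm LinearMap.id v W) := by
    induction W using tensor3_induction with
    | add a b ha hb => simp only [map_add, ha, hb]
    | tmul x y z => simp only [coantipodeForm_tmul, map_mul, AlgHom.comp_apply,
        AlgHom.toLinearMap_apply, LinearMap.id_apply]
  rw [← h1, ← h2, e]

/-- Apply χ to b = E(b₍₀₎) b₍₁₎ and use χ(c h) = ε(h) χ(c). -/
theorem cotwist_E
    (hv : IsComoduleAlgebraHom (RightComoduleAlgebra.regular Q.toQuasiBialgebra) R v) (b : B) :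
    Q.cotwist R v (Q.E R v b) = Q.cotwist R v b := by
  have e (W) : Q.cotwist R v (sandwich (Q.E R v) 1 v.toLinearMap W) =
      Q.cotwist R v (Q.E R v (contractRight Q.counit W)) := by
    induction W using tensor2_induction with
    | add a b ha hb => simp only [map_add, ha, hb]
    | tmul c h =>
      rw [sandwich_tmul, mul_one, AlgHom.toLinearMap_apply, Q.cotwist_mul_map hv,
        contractRight_tmul, map_smul, map_smul]
  have h := e (R.rho b)
  rwa [Q.E_rho hv, contractRight_rho, eq_comm] at h

theorem E_E (hv : IsComoduleAlgebraHom (RightComoduleAlgebra.regular Q.toQuasiBialgebra) R v)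
    (b : B) : Q.E R v (Q.E R v b) = Q.E R v b := by
  rw [E_eq_untwist Q R v (Q.E R v b), Q.cotwist_E hv, ← E_eq_untwist]

theorem E_coinv
    (hv : IsComoduleAlgebraHom (RightComoduleAlgebra.regular Q.toQuasiBialgebra) R v)
    (a : Q.coinv R v) : Q.E R v a = a := by
  obtain ⟨_, b, rfl⟩ := a
  exact Q.E_E hv b

/-- `θ(a) = a₍₀₎ v(β S(a₍₁₎))`. -/
theorem theta_eq_cotwist
    (hv : IsComoduleAlgebraHom (RightComoduleAlgebra.regular Q.toQuasiBialgebra) R v)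
    (a : Q.coinv R v) : Q.theta R v a = Q.cotwist R v a := by
  have e (Z) : sandwich ((Q.coinv R v).subtype ∘ₗ (Q.coinvData R v).act.flip a) 1 v.toLinearMap
      (TensorProduct.map LinearMap.id (sandwich LinearMap.id Q.beta Q.S.toLinearMap) Z) =
      Q.betaForm v (Q.coinvForm R v (mapFirst v (H ⊗[k] H) Z * ((a : B) ⊗ₜ 1))) := by
    induction Z using tensor3_induction with
    | add a b ha hb => simp only [map_add, add_mul, ha, hb]
    | tmul x y z =>
      rw [mapFirst_tmul, tmul_mul_tmul, mul_one, coinvForm_tmul, betaForm_tmul,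
        TensorProduct.map_tmul, sandwich_tmul, sandwich_tmul]
      have h : ((Q.coinvData R v).act x a : B) = Q.E R v (v x * a) := rfl
      simp [h, mul_assoc]
  refine (e _).trans ?_
  -- The expansion E(x¹ a) x² β S(x³) is χ(E(a)) by `rho_E`, and E(a) = a.
  rw [← coinvRho_apply, ← Q.rho_E hv, Q.E_coinv hv, cotwist_apply]

/-- In `twist_mul`, Ψ(x¹ ▷ χ(b)) = Ψ(χ(x¹ b)) = E(x¹ b), so the factors assemble into ρ(E(b)) ρ(b').
-/
theorem twist_mul_cotwist
    (hv : IsComoduleAlgebraHom (RightComoduleAlgebra.regular Q.toQuasiBialgebra) R v) (b b' : B) :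
    (Q.twist v).mul (Q.cotwist R v b) (Q.cotwist R v b') = Q.cotwist R v (Q.E R v b * b') := by
  rw [twist_mul, cotwist_apply Q R v (Q.E R v b * b'), map_mul, Q.rho_E hv, coinvRho_apply,
    cotwist_apply Q R v b']
  generalize (Q.Phi⁻¹).val = Z, R.rho b' = W
  have hadd (c c' : B) : Q.adj v (c + c') = Q.adj v c + Q.adj v c' := sandwich_add _ _ _ _
  induction Z using tensor3_induction with
  | add a b ha hb => simp only [map_add, add_mul, ha, hb]
  | tmul x y z =>
    rw [prodForm_tmul, untwistAct_apply, ← Q.cotwist_map_mul hv, ← E_eq_untwist, mapFirst_tmul,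
      tmul_mul_tmul, mul_one, coinvForm_tmul]
    induction W using tensor2_induction with
    | add a b ha hb => simp only [map_add, mul_add, add_mul, ha, hb]
    | tmul c g =>
      rw [tmul_mul_tmul, betaForm_tmul, betaForm_tmul, Q.S_mul, map_mul v]
      simp only [mul_assoc]

theorem theta_isHom
    (hv : IsComoduleAlgebraHom (RightComoduleAlgebra.regular Q.toQuasiBialgebra) R v) :
    (Q.coinvData R v).IsHom (Q.twist v) (Q.theta R v) where
  map_mul a a' := by
    rw [Q.theta_eq_cotwist hv, Q.theta_eq_cotwist hv, Q.theta_eq_cotwist hv,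
      Q.twist_mul_cotwist hv, Q.E_coinv hv]
    exact Q.cotwist_E hv _
  map_one := by
    rw [Q.theta_eq_cotwist hv]
    change Q.betaForm v (R.rho 1) = v Q.beta
    rw [map_one]
    refine (Q.betaForm_tmul v 1 1).trans ?_
    simp [Q.S_one]
  map_act h a := by
    rw [Q.theta_eq_cotwist hv, Q.theta_eq_cotwist hv, ← Q.cotwist_map_mul hv]
    exact Q.cotwist_E hv _

/-- Ψ is a left inverse: Ψ(θ(a)) = Ψ(χ(a)) = E(a) = a. -/
theorem theta_injective
    (hv : IsComoduleAlgebraHom (RightComoduleAlgebra.regular Q.toQuasiBialgebra) R v) :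
    Function.Injective (Q.theta R v) := by
  intro a a' h
  rw [Q.theta_eq_cotwist hv, Q.theta_eq_cotwist hv] at h
  refine Subtype.ext ?_
  rw [← Q.E_coinv hv a, ← Q.E_coinv hv a', E_eq_untwist, E_eq_untwist, h]

end QuasiHopfAlgebra

end

end QuasiHopf

theorem mainTheorem2 {k H B : Type*} [Field k] [Ring H] [Algebra k H] [Ring B] [Algebra k B]
    (Q : QuasiHopf.QuasiHopfAlgebra k H)
    (R : QuasiHopf.RightComoduleAlgebra Q.toQuasiBialgebra B)
    (v : H →ₐ[k] B)
    (hv : QuasiHopf.IsComoduleAlgebraHom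
      (QuasiHopf.RightComoduleAlgebra.regular Q.toQuasiBialgebra) R v) :
    (Q.coinvData R v).IsModuleAlgebra Q.toQuasiBialgebra ∧
      (Q.twist v).IsModuleAlgebra Q.toQuasiBialgebra ∧
      (Q.coinvData R v).IsHom (Q.twist v) (Q.theta R v) ∧
      Function.Injective (Q.theta R v) :=
  ⟨(Q.twist_isModuleAlgebra v).of_injective (Q.theta_isHom hv) (Q.theta_injective hv),
    Q.twist_isModuleAlgebra v, Q.theta_isHom hv, Q.theta_injective hv⟩
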